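/- For a finite sequence $S$ let $|S|$ be its length and $\|S\|$ the number of distinct symbols occurring in it. Say that $S$ has order $5$ if it contains no (not necessarily contiguous) alternating subsequence $a\,b\,a\,b\,a\,b\,a$ of length $7$ with $a\ne b$. A sequence is $2$-sparse if no two consecutive symbols are equal, and a block is a sequence of pairwise distinct symbols. For integers $n,m\ge 1$ let $\lambda_5(n)$ be the maximum length of a $2$-sparse sequence $S$ of order $5$ with $\|S\|=n$, and let $\lambda_5(n,m)$ be the maximum length of a sequence $S$ of order $5$ with $\|S\|=n$ that can be partitioned into at most $m$ contiguous blocks. Define Ackermann's function by $a_{1,j}=2^j$ for $j\ge1$, $a_{i,1}=2$ for $i\ge 2$, and $a_{i,j}=w\cdot a_{i-1,w}$ with $w=a_{i,j-1}$ for $i,j\ge 2$. Let $\alpha(n,m)=\min\{i\ge 1 : a_{i,j}\ge m\}$, where $j=\max\{\lceil n/m\rceil,3\}$, and $\alpha(n)=\alpha(n,n)$. Theorem. The maxima $\lambda_5(n)$ and $\lambda_5(n,m)$ exist for all $n,m\ge1$, and $$\lambda_5(n)=O\bigl(n\,\alpha(n)\,2^{\alpha(n)}\bigr)\qquad\text{and}\qquad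 \lambda_5(n,m)=m+O\bigl(n\,\alpha(n,m)\,2^{\alpha(n,m)}\bigr),$$ that is, there is an absolute constant $C$ such that $\lambda_5(n)\le C\,n\,\alpha(n)2^{\alpha(n)}$ and $|\lambda_5(n,m)-m|\le C\,n\,\alpha(n,m)2^{\alpha(n,m)}$ for all integers $n,m\ge 1$. -/

import Mathlib

namespace DavenportSchinzel

/-- Two sequences are isomorphic if they are equal up to an injective renaming of the alphabet of
the first one. -/
def Isomorphic (σ τ : List ℕ) : Prop :=
  ∃ f : ℕ → ℕ, Set.InjOn f {x | x ∈ σ} ∧ σ.map f = τ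

/-- `σ ≺ S`: the sequence `σ` is isomorphic to a (not necessarily contiguous) subsequence of `S`. -/
def Occurs (σ S : List ℕ) : Prop :=
  ∃ τ : List ℕ, τ.Sublist S ∧ Isomorphic σ τ

/-- `‖S‖`, the number of distinct symbols occurring in `S`. -/
def alphabetSize (S : List ℕ) : ℕ := S.toFinset.card

/-- `S` is `k`-sparse: equal symbols at different positions are at distance at least `k`. -/
def Sparse (k : ℕ) (S : List ℕ) : Prop :=
  ∀ (i j : ℕ) (hij : i < j) (hj : j < S.length), S[i] = S[j] → k ≤ j - i

/-- `S` can be partitioned into at most `m` blocks, a block being a sequence of distinct symbols. -/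
def HasBlocks (m : ℕ) (S : List ℕ) : Prop :=
  ∃ L : List (List ℕ), L.flatten = S ∧ L.length ≤ m ∧ ∀ B ∈ L, B.Nodup

/-- Lengths of the `σ`-free, `‖σ‖`-sparse sequences with exactly `n` distinct symbols. -/
def sparseLengths (σ : List ℕ) (n : ℕ) : Set ℕ :=
  {l | ∃ S : List ℕ, ¬ Occurs σ S ∧ alphabetSize S = n ∧ Sparse (alphabetSize σ) S ∧ S.length = l}

/-- Lengths of the `σ`-free sequences with exactly `n` distinct symbols and at most `m` blocks. -/
def blockedLengths (σ : List ℕ) (n m : ℕ) : Set ℕ :=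
  {l | ∃ S : List ℕ, ¬ Occurs σ S ∧ alphabetSize S = n ∧ HasBlocks m S ∧ S.length = l}

/-- The extremal function `Ex(σ, n)`. -/
noncomputable def exSparse (σ : List ℕ) (n : ℕ) : ℕ := sSup (sparseLengths σ n)

/-- The extremal function `Ex(σ, n, m)`. -/
noncomputable def exBlocked (σ : List ℕ) (n m : ℕ) : ℕ := sSup (blockedLengths σ n m)

/-- The alternating sequence `0 1 0 1 ⋯` of length `k`. -/
def alternating (k : ℕ) : List ℕ := (List.range k).map (· % 2)

/-- `λ_s(n)`: maximum length of a 2-sparse order-`s` Davenport–Schinzel sequence over `n` letters. -/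
noncomputable def dsSparse (s n : ℕ) : ℕ := exSparse (alternating (s + 2)) n

/-- `λ_s(n, m)`: maximum length of an order-`s` Davenport–Schinzel sequence over `n` letters that
can be partitioned into at most `m` blocks. -/
noncomputable def dsBlocked (s n m : ℕ) : ℕ := exBlocked (alternating (s + 2)) n m

/-- The Ackermann function `a_{i,j}`, meaningful for `i, j ≥ 1` (it is set to `0` otherwise):
`a_{1,j} = 2^j`, `a_{i,1} = 2`, and `a_{i,j} = w * a_{i-1,w}` with `w = a_{i,j-1}`. -/
def acker : ℕ → ℕ → ℕ
  | 0, _ => 0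
  | _ + 1, 0 => 0
  | 1, j + 1 => 2 ^ (j + 1)
  | _ + 2, 1 => 2
  | i + 2, j + 2 => acker (i + 2) (j + 1) * acker (i + 1) (acker (i + 2) (j + 1))
termination_by i j => (i, j)

/-- `α(n, m)`: the least `i ≥ 1` with `a_{i,j} ≥ m`, where `j = max {⌈n/m⌉, 3}`. -/
noncomputable def invAck₂ (n m : ℕ) : ℕ :=
  sInf {i | 1 ≤ i ∧ m ≤ acker i (max ⌈(n : ℚ) / (m : ℚ)⌉₊ 3)}

/-- `α(n) = α(n, n)`. -/
noncomputable def invAck (n : ℕ) : ℕ := invAck₂ n n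

end DavenportSchinzel

/-! Cut a sequence of m blocks into groups of g consecutive blocks. A symbol is either local to one
group or has a first group, a last group and possibly middle groups. Within a group, first and last
parts have order one less and middle parts order two less, because their symbols recur outside. The
pairs (group, symbol) are counted by the contraction, which keeps one occurrence of each non-local
symbol per group and is itself a sequence of the same order whose blocks are the groups. With i the
level in the Ackermann hierarchy, the coefficients of n then satisfy c_s(i+1) = 2 c_{s-1}(i+1) +
c_{s-2}(i+1) c_s(i). This is linear in i for order three and O(2^i) for order four, but factorial
for order five.

Order five needs a better treatment of the middle. Rank the boundaries between blocks, with group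
boundaries above all inner ones, and let the separation of two blocks be the largest rank between
them. An occurrence is a jump if it is further separated from the next occurrence of its symbol than
from the first one. For middle occurrences of two symbols in one group that are jumps in neither
direction, the two symbols alternate once more before or behind the group (`hasOrder_good`), so
these occurrences have order two there instead of three (`HasOrder.two_of_five`). Jumps are rare:
one whose next occurrence is in its own group lies in the first group of its symbol, and every other
one contracts to a jump (`card_jumps_le`). Jump coefficients therefore add up instead of multiplying
and stay cubic in i. What remains is c_5(i+1) = 2 c_5(i) + 2 c_4(i+1) + O(i^4), which is O(i 2^i).

At level i with parameter j the coefficient of m is polynomial in j, for m up to about the cube of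
a_{i,j} (`levelBounds_acker`). One level more costs a constant factor and makes that polynomial
harmless; this settles m ≤ n. For m > n, deleting at most one position per block leaves a 2-sparse
sequence. Such a sequence is cut twice around first and last occurrences, lowering the order from
five to three to one; the final pieces are blocks, and the blocked bound itself limits their number
(`card_le_of_sparse`). -/

namespace DavenportSchinzel

noncomputable section

open scoped Classical

/-! ### Alternations in sets of positions

A sequence is modelled by a labelling `sym` of a linear order of positions; its subsequences are
the finite sets of positions. -/

/-- The number of symbols of `P`. -/
def numSym {ι : Type*} (sym : ι → ℕ) (P : Finset ι) : ℕ := (P.image sym).card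

theorem numSym_mono {ι : Type*} {sym : ι → ℕ} {P Q : Finset ι} (hQ : Q ⊆ P) :
    numSym sym Q ≤ numSym sym P :=
  Finset.card_le_card (Finset.image_subset_image hQ)

section Alternation

variable {ι : Type*} [LinearOrder ι]

/-- The word `a b a b ⋯` of length `k`. -/
def altWord : ℕ → ℕ → ℕ → List ℕ
  | 0, _, _ => []
  | k + 1, a, b => a :: altWord k b a

/-- `P` contains an alternation `a b a b ⋯` of length `k`. -/
def HasAlt (sym : ι → ℕ) (P : Finset ι) (k a b : ℕ) : Prop :=
  ∃ l : List ι, l.Pairwise (· < ·) ∧ (∀ p ∈ l, p ∈ P) ∧ l.map sym = altWord k a b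

/-- `P` has order `s`: it contains no alternation of length `s + 2`. -/
def HasOrder (sym : ι → ℕ) (s : ℕ) (P : Finset ι) : Prop :=
  ∀ a b, a ≠ b → ¬ HasAlt sym P (s + 2) a b

variable {sym : ι → ℕ} {P Q : Finset ι} {s k a b : ℕ}

theorem HasOrder.mono (h : HasOrder sym s P) (hQ : Q ⊆ P) : HasOrder sym s Q :=
  fun a b hab ⟨l, h1, h2, h3⟩ => h a b hab ⟨l, h1, fun p hp => hQ (h2 p hp), h3⟩

theorem altWord_succ (k a b : ℕ) :
    altWord (k + 1) a b = altWord k a b ++ [if Even k then a else b] := by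
  induction k generalizing a b with
  | zero => simp [altWord]
  | succ k ih =>
    rw [altWord, ih b a, altWord]
    by_cases hk : Even k <;> simp [hk, Nat.even_add_one]

theorem HasAlt.exists_left (h : HasAlt sym P (k + 1) a b) : ∃ p ∈ P, sym p = a := by
  obtain ⟨l, -, h2, h3⟩ := h
  cases l with
  | nil => simp [altWord] at h3
  | cons p l =>
    simp only [List.map_cons, altWord, List.cons.injEq] at h3
    exact ⟨p, h2 p (by simp), h3.1⟩

theorem HasAlt.exists_right (h : HasAlt sym P (k + 2) a b) : ∃ p ∈ P, sym p = b := by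
  obtain ⟨l, h1, h2, h3⟩ := h
  cases l with
  | nil => simp [altWord] at h3
  | cons p l =>
    simp only [List.map_cons, altWord, List.cons.injEq] at h3
    refine HasAlt.exists_left (k := k) (a := b) (b := a) ⟨l, (List.pairwise_cons.1 h1).2,
      fun q hq => h2 q (by simp [hq]), by simpa [altWord] using h3.2⟩

/-- Symbols that occur again behind `Q` lower the order of `Q` by one. -/
theorem HasOrder.of_after (h : HasOrder sym (s + 1) P) (hQ : Q ⊆ P)
    (hA : ∀ x ∈ Q, ∃ p ∈ P, sym p = sym x ∧ ∀ y ∈ Q, y < p) : HasOrder sym s Q := by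
  intro a b hab hal
  obtain ⟨x, hx, rfl⟩ := hal.exists_left
  obtain ⟨y, hy, rfl⟩ := hal.exists_right
  obtain ⟨p, hp, hpx, hpQ⟩ := hA x hx
  obtain ⟨q, hq, hqy, hqQ⟩ := hA y hy
  obtain ⟨l, h1, h2, h3⟩ := hal
  -- The parity of the length decides which of the two symbols continues the alternation.
  refine h _ _ hab ⟨l ++ [if Even (s + 2) then p else q], ?_, ?_, ?_⟩
  · refine List.pairwise_append.2 ⟨h1, by simp, fun u hu v hv => ?_⟩
    rw [List.mem_singleton] at hv
    subst hv
    split_ifs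
    exacts [hpQ u (h2 u hu), hqQ u (h2 u hu)]
  · intro u hu
    rw [List.mem_append, List.mem_singleton] at hu
    rcases hu with hu | rfl
    · exact hQ (h2 u hu)
    · split_ifs <;> assumption
  · rw [show s + 1 + 2 = s + 2 + 1 by ring, altWord_succ, List.map_append, h3, List.map_singleton]
    split_ifs <;> simp [hpx, hqy]

/-- Symbols that occur before `Q` lower the order of `Q` by one. -/
theorem HasOrder.of_before (h : HasOrder sym (s + 1) P) (hQ : Q ⊆ P)
    (hB : ∀ x ∈ Q, ∃ p ∈ P, sym p = sym x ∧ ∀ y ∈ Q, p < y) : HasOrder sym s Q := by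
  intro a b hab hal
  obtain ⟨y, hy, rfl⟩ := hal.exists_right
  obtain ⟨q, hq, hqy, hqQ⟩ := hB y hy
  obtain ⟨l, h1, h2, h3⟩ := hal
  refine h _ _ hab.symm ⟨q :: l, List.pairwise_cons.2 ⟨fun u hu => hqQ u (h2 u hu), h1⟩, ?_, ?_⟩
  · intro u hu
    rcases List.mem_cons.1 hu with rfl | hu
    exacts [hq, hQ (h2 u hu)]
  · rw [List.map_cons, h3, hqy]
    rfl

/-- Symbols that occur before and behind `Q` lower the order of `Q` by two. -/
theorem HasOrder.of_before_after (h : HasOrder sym (s + 2) P) (hQ : Q ⊆ P)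
    (hB : ∀ x ∈ Q, ∃ p ∈ P, sym p = sym x ∧ ∀ y ∈ Q, p < y)
    (hA : ∀ x ∈ Q, ∃ p ∈ P, sym p = sym x ∧ ∀ y ∈ Q, y < p) : HasOrder sym s Q := by
  -- The occurrences behind `Q` must survive the first reduction. So it is applied to all
  -- occurrences of symbols of `Q` from the start of `Q` on, and only then is the tail used.
  let R := P.filter fun p => (∃ y ∈ Q, y ≤ p) ∧ ∃ y ∈ Q, sym y = sym p
  have hR : HasOrder sym (s + 1) R := by
    refine h.of_before (Finset.filter_subset _ _) fun x hx => ?_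
    obtain ⟨-, -, y, hy, hyx⟩ := Finset.mem_filter.1 hx
    obtain ⟨p, hp, hpy, hpQ⟩ := hB y hy
    refine ⟨p, hp, hpy.trans hyx, fun z hz => ?_⟩
    obtain ⟨-, ⟨u, hu, huz⟩, -⟩ := Finset.mem_filter.1 hz
    exact (hpQ u hu).trans_le huz
  refine hR.of_after (fun x hx => Finset.mem_filter.2 ⟨hQ hx, ⟨x, hx, le_rfl⟩, x, hx, rfl⟩)
    fun x hx => ?_
  obtain ⟨p, hp, hpx, hpQ⟩ := hA x hx
  exact ⟨p, Finset.mem_filter.2 ⟨hp, ⟨x, hx, (hpQ x hx).le⟩, x, hx, hpx.symm⟩, hpx, hpQ⟩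

/-- In a set of order `5`, if for all symbols `a ≠ b` of `Q` an `a` precedes a `b` either before
or behind `Q`, and all symbols of `Q` occur before and behind `Q`, then `Q` has order `2`. -/
theorem HasOrder.two_of_five (h : HasOrder sym 5 P) (hQ : Q ⊆ P)
    (hB : ∀ x ∈ Q, ∃ p ∈ P, sym p = sym x ∧ ∀ y ∈ Q, p < y)
    (hA : ∀ x ∈ Q, ∃ p ∈ P, sym p = sym x ∧ ∀ y ∈ Q, y < p)
    (hab : ∀ x ∈ Q, ∀ y ∈ Q, ∃ p ∈ P, ∃ q ∈ P, sym p = sym x ∧ sym q = sym y ∧ p < q ∧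
      ((∀ z ∈ Q, q < z) ∨ ∀ z ∈ Q, z < p)) : HasOrder sym 2 Q := by
  intro a b hne hal
  obtain ⟨x, hx, rfl⟩ := hal.exists_left
  obtain ⟨y, hy, rfl⟩ := hal.exists_right
  obtain ⟨l, h1, h2, h3⟩ := hal
  obtain ⟨p, hp, q, hq, hpx, hqy, hpq, hcase⟩ := hab x hx y hy
  rcases hcase with hc | hc
  · obtain ⟨u, hu, hux, huQ⟩ := hA x hx
    -- The forbidden word is assembled as `a b | a b a b | a`.
    refine h _ _ hne ⟨p :: q :: (l ++ [u]), ?_, ?_, ?_⟩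
    · simp only [List.pairwise_cons, List.mem_cons, List.mem_append, List.pairwise_append]
      refine ⟨?_, ?_, h1, by simp, ?_⟩
      · rintro z (rfl | hz | hz)
        · exact hpq
        · exact hpq.trans (hc z (h2 z hz))
        · simp only [List.not_mem_nil, or_false] at hz
          exact hpq.trans ((hc x hx).trans (hz ▸ huQ x hx))
      · rintro z (hz | hz)
        · exact hc z (h2 z hz)
        · simp only [List.not_mem_nil, or_false] at hz
          exact (hc x hx).trans (hz ▸ huQ x hx)
      · rintro z hz w hw
        simp only [List.not_mem_nil, or_false] at hw
        exact hw ▸ huQ z (h2 z hz)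
    · simp only [List.mem_cons, List.mem_append, List.not_mem_nil, or_false]
      rintro z (rfl | rfl | hz | rfl)
      exacts [hp, hq, hQ (h2 z hz), hu]
    · simp [h3, hpx, hqy, hux, altWord]
  · obtain ⟨u, hu, huy, huQ⟩ := hB y hy
    -- Here it is `b | a b a b | a b`, so the roles of the symbols are exchanged.
    refine h _ _ hne.symm ⟨u :: (l ++ [p, q]), ?_, ?_, ?_⟩
    · simp only [List.pairwise_cons, List.mem_cons, List.mem_append, List.pairwise_append]
      refine ⟨?_, h1, by simpa using hpq, ?_⟩
      · rintro z (hz | rfl | hz)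
        · exact huQ z (h2 z hz)
        · exact (huQ x hx).trans (hc x hx)
        · simp only [List.not_mem_nil, or_false] at hz
          exact (huQ x hx).trans ((hc x hx).trans (hz ▸ hpq))
      · rintro z hz w (rfl | hw)
        · exact hc z (h2 z hz)
        · simp only [List.not_mem_nil, or_false] at hw
          exact (hc z (h2 z hz)).trans (hw ▸ hpq)
    · simp only [List.mem_cons, List.mem_append, List.not_mem_nil, or_false]
      rintro z (rfl | hz | rfl | rfl)
      exacts [hu, hQ (h2 z hz), hp, hq]
    · simp [h3, hpx, hqy, huy, altWord]

end Alternation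

/-! ### Blocked sequences of order at most two -/

/-- `b` cuts `P` into blocks: positions in the same block carry different symbols. -/
def IsBlocked (sym b : ℕ → ℕ) (P : Finset ℕ) : Prop :=
  ∀ p ∈ P, ∀ q ∈ P, sym p = sym q → b p = b q → p = q

variable {sym b : ℕ → ℕ} {P Q : Finset ℕ} {m : ℕ}

theorem IsBlocked.mono (h : IsBlocked sym b P) (hQ : Q ⊆ P) : IsBlocked sym b Q :=
  fun p hp q hq => h p (hQ hp) q (hQ hq)

theorem IsBlocked.card_le_mul (h : IsBlocked sym b P) (hm : ∀ p ∈ P, b p < m) :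
    P.card ≤ m * numSym sym P := by
  have : P.card ≤ (P.image sym ×ˢ Finset.range m).card := by
    refine Finset.card_le_card_of_injOn (fun p => (sym p, b p)) (fun p hp => ?_)
      fun p hp q hq hpq => ?_
    · simp only [Finset.coe_product, Set.mem_prod, Finset.mem_coe, Finset.mem_range]
      exact ⟨Finset.mem_image_of_mem _ hp, hm p hp⟩
    · simp only [Prod.mk.injEq] at hpq
      exact h p hp q hq hpq.1 hpq.2
  rwa [Finset.card_product, Finset.card_range, mul_comm] at this

theorem lt_of_monotone_lt {ι κ : Type*} [LinearOrder ι] [LinearOrder κ] {b : ι → κ}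
    (hb : Monotone b) {x y : ι} (h : b x < b y) : x < y :=
  lt_of_not_ge fun h' => absurd (hb h') (not_le.2 h)

theorem card_filter_first_le (P : Finset ℕ) :
    (P.filter fun p => ∀ x ∈ P, sym x = sym p → p ≤ x).card ≤ numSym sym P := by
  refine Finset.card_le_card_of_injOn sym (fun p hp => ?_) fun p hp q hq hpq => ?_
  · exact Finset.mem_coe.2 (Finset.mem_image_of_mem _ (Finset.mem_filter.1 hp).1)
  · obtain ⟨hp1, hp2⟩ := Finset.mem_filter.1 hp
    obtain ⟨hq1, hq2⟩ := Finset.mem_filter.1 hq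
    exact le_antisymm (hp2 q hq1 hpq.symm) (hq2 p hp1 hpq)

theorem card_filter_last_le (P : Finset ℕ) :
    (P.filter fun p => ∀ x ∈ P, sym x = sym p → x ≤ p).card ≤ numSym sym P := by
  refine Finset.card_le_card_of_injOn sym (fun p hp => ?_) fun p hp q hq hpq => ?_
  · exact Finset.mem_coe.2 (Finset.mem_image_of_mem _ (Finset.mem_filter.1 hp).1)
  · obtain ⟨hp1, hp2⟩ := Finset.mem_filter.1 hp
    obtain ⟨hq1, hq2⟩ := Finset.mem_filter.1 hq
    exact le_antisymm (hq2 p hp1 hpq) (hp2 q hq1 hpq.symm)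

/-- Blocked sequences of order one. -/
theorem card_le_of_order_one (hP : HasOrder sym 1 P) (hb : Monotone b) (h : IsBlocked sym b P)
    (hm : ∀ p ∈ P, b p < m) : P.card ≤ numSym sym P + m := by
  rw [← Finset.card_filter_add_card_filter_not (s := P) (fun p => ∀ x ∈ P, sym x = sym p → p ≤ x)]
  refine add_le_add (card_filter_first_le P) ?_
  rw [← Finset.card_range m]
  -- A block holds at most one non-first occurrence: for two of them at `p < q`, an earlier
  -- occurrence of the symbol of `q` completes an alternation of length three.
  refine Finset.card_le_card_of_injOn b (fun p hp => ?_) fun p hp q hq hpq => ?_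
  · simpa using hm p (Finset.mem_filter.1 hp).1
  · by_contra hne
    wlog hlt : p < q generalizing p q
    · exact this q hq p hp hpq.symm (Ne.symm hne) (lt_of_le_of_ne (not_lt.1 hlt) (Ne.symm hne))
    obtain ⟨hp1, -⟩ := Finset.mem_filter.1 hp
    obtain ⟨hq1, hq2⟩ := Finset.mem_filter.1 hq
    push Not at hq2
    obtain ⟨x, hx, hxq, hxlt⟩ := hq2
    have hbx : b x < b p := by
      rw [hpq]
      exact lt_of_le_of_ne (hb hxlt.le) fun h' => hxlt.ne (h x hx q hq1 hxq h')
    have hsym : sym q ≠ sym p := fun h' => hne (h p hp1 q hq1 h'.symm hpq)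
    refine hP _ _ hsym ⟨[x, p, q], ?_, ?_, ?_⟩
    · have := lt_of_monotone_lt hb hbx
      simp [this, hlt, hxlt]
    · simp [hx, hp1, hq1]
    · simp [hxq, altWord]

/-- Blocked sequences of order two. -/
theorem card_le_of_order_two (hP : HasOrder sym 2 P) (hb : Monotone b) (h : IsBlocked sym b P)
    (hm : ∀ p ∈ P, b p < m) : P.card ≤ 2 * numSym sym P + m := by
  rw [← Finset.card_filter_add_card_filter_not (s := P) (fun p => ∀ x ∈ P, sym x = sym p → p ≤ x),
    two_mul, add_assoc]
  refine add_le_add (card_filter_first_le P) ?_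
  rw [← Finset.card_filter_add_card_filter_not (s := P.filter _)
    (fun p => ∀ x ∈ P, sym x = sym p → x ≤ p)]
  refine add_le_add ((Finset.card_le_card ?_).trans (card_filter_last_le P)) ?_
  · exact Finset.filter_subset_filter _ (Finset.filter_subset _ _)
  rw [← Finset.card_range m]
  -- As for order one, but now `p` also recurs behind the block, which gives length four.
  refine Finset.card_le_card_of_injOn b (fun p hp => ?_) fun p hp q hq hpq => ?_
  · simpa using hm p (Finset.mem_filter.1 (Finset.mem_filter.1 hp).1).1
  · by_contra hne
    wlog hlt : p < q generalizing p q
    · exact this q hq p hp hpq.symm (Ne.symm hne) (lt_of_le_of_ne (not_lt.1 hlt) (Ne.symm hne))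
    obtain ⟨hp0, hp2⟩ := Finset.mem_filter.1 hp
    obtain ⟨hp1, -⟩ := Finset.mem_filter.1 hp0
    obtain ⟨hq0, -⟩ := Finset.mem_filter.1 hq
    obtain ⟨hq1, hq2⟩ := Finset.mem_filter.1 hq0
    push Not at hq2 hp2
    obtain ⟨x, hx, hxq, hxlt⟩ := hq2
    obtain ⟨y, hy, hyp, hylt⟩ := hp2
    have hbx : b x < b p := by
      rw [hpq]
      exact lt_of_le_of_ne (hb hxlt.le) fun h' => hxlt.ne (h x hx q hq1 hxq h')
    have hby : b q < b y := by
      rw [← hpq]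
      exact lt_of_le_of_ne (hb hylt.le) fun h' => hylt.ne (h p hp1 y hy hyp.symm h')
    have hsym : sym q ≠ sym p := fun h' => hne (h p hp1 q hq1 h'.symm hpq)
    have h1 := lt_of_monotone_lt hb hbx
    have h2 := lt_of_monotone_lt hb hby
    refine hP _ _ hsym ⟨[x, p, q, y], ?_, ?_, ?_⟩
    · simp [h1, hlt, hxlt, h2, hylt, h1.trans hylt]
    · simp [hx, hp1, hq1, hy]
    · simp [hxq, hyp, altWord]

/-! ### Grouping blocks -/

section Grouping

set_option linter.unusedSectionVars false

variable {ι κ : Type*} [LinearOrder ι] [LinearOrder κ]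

/-- The symbol at `p` occurs in a group before that of `p`. -/
def HasBefore (sym : ι → ℕ) (grp : ι → κ) (P : Finset ι) (p : ι) : Prop :=
  ∃ x ∈ P, sym x = sym p ∧ grp x < grp p

/-- The symbol at `p` occurs in a group behind that of `p`. -/
def HasAfter (sym : ι → ℕ) (grp : ι → κ) (P : Finset ι) (p : ι) : Prop :=
  ∃ x ∈ P, sym x = sym p ∧ grp p < grp x

/-- The occurrences of symbols that are confined to one group. -/
def locPart (sym : ι → ℕ) (grp : ι → κ) (P : Finset ι) : Finset ι :=
  P.filter fun p => ¬ HasBefore sym grp P p ∧ ¬ HasAfter sym grp P p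

/-- The occurrences of the other symbols in their first group. -/
def fstPart (sym : ι → ℕ) (grp : ι → κ) (P : Finset ι) : Finset ι :=
  P.filter fun p => ¬ HasBefore sym grp P p ∧ HasAfter sym grp P p

/-- The occurrences of the other symbols in their last group. -/
def lstPart (sym : ι → ℕ) (grp : ι → κ) (P : Finset ι) : Finset ι :=
  P.filter fun p => ¬ HasAfter sym grp P p ∧ HasBefore sym grp P p

/-- The occurrences that are neither in the first nor in the last group of their symbol. -/
def midPart (sym : ι → ℕ) (grp : ι → κ) (P : Finset ι) : Finset ι :=
  P.filter fun p => HasBefore sym grp P p ∧ HasAfter sym grp P p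

/-- The first occurrence in each group of every symbol that is not confined to one group. -/
def contraction (sym : ι → ℕ) (grp : ι → κ) (P : Finset ι) : Finset ι :=
  P.filter fun p => (HasBefore sym grp P p ∨ HasAfter sym grp P p) ∧
    ∀ x ∈ P, sym x = sym p → grp x = grp p → p ≤ x

/-- `p` is a jump: the separation of `p` from the next occurrence of its symbol exceeds the
separation of `p` from the first occurrence (up to the tolerance `e`). -/
def IsJump (sym : ι → ℕ) (σ : ι → ι → ℕ) (e : ℕ) (P : Finset ι) (p : ι) : Prop :=
  ∃ f ∈ P, ∃ p' ∈ P, sym f = sym p ∧ sym p' = sym p ∧ (∀ x ∈ P, sym x = sym p → f ≤ x) ∧ p < p' ∧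
    (∀ x ∈ P, sym x = sym p → p < x → p' ≤ x) ∧ σ f p < σ p p' + e

/-- The jumps of `P`. -/
def jumps (sym : ι → ℕ) (σ : ι → ι → ℕ) (e : ℕ) (P : Finset ι) : Finset ι :=
  P.filter (IsJump sym σ e P)

variable {sym : ι → ℕ} {grp : ι → κ} {P : Finset ι}

theorem mem_locPart {p : ι} : p ∈ locPart sym grp P ↔
    p ∈ P ∧ ¬ HasBefore sym grp P p ∧ ¬ HasAfter sym grp P p := Finset.mem_filter

theorem mem_contraction {p : ι} : p ∈ contraction sym grp P ↔
    p ∈ P ∧ (HasBefore sym grp P p ∨ HasAfter sym grp P p) ∧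
      ∀ x ∈ P, sym x = sym p → grp x = grp p → p ≤ x := Finset.mem_filter

theorem jumps_congr {σ τ : ι → ι → ℕ} {e : ℕ} (h : ∀ x ∈ P, ∀ y ∈ P, σ x y = τ x y) :
    jumps sym σ e P = jumps sym τ e P := by
  refine Finset.filter_congr fun p hp => ?_
  constructor <;> rintro ⟨f, hf, p', hp', h1, h2, h3, h4, h5, h6⟩
  · exact ⟨f, hf, p', hp', h1, h2, h3, h4, h5, by rwa [← h f hf p hp, ← h p hp p' hp']⟩
  · exact ⟨f, hf, p', hp', h1, h2, h3, h4, h5, by rwa [h f hf p hp, h p hp p' hp']⟩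

theorem exists_mem_contraction {p : ι} (hp : p ∈ P)
    (h : HasBefore sym grp P p ∨ HasAfter sym grp P p) :
    ∃ x ∈ contraction sym grp P, sym x = sym p ∧ grp x = grp p ∧ x ≤ p := by
  have hne : (P.filter fun x => sym x = sym p ∧ grp x = grp p).Nonempty :=
    ⟨p, Finset.mem_filter.2 ⟨hp, rfl, rfl⟩⟩
  obtain ⟨hx, hxs, hxg⟩ := Finset.mem_filter.1 (Finset.min'_mem _ hne)
  have hmin : ∀ y ∈ P, sym y = sym p → grp y = grp p → Finset.min' _ hne ≤ y :=
    fun y hy h1 h2 => Finset.min'_le _ _ (Finset.mem_filter.2 ⟨hy, h1, h2⟩)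
  refine ⟨_, Finset.mem_filter.2 ⟨hx, ?_, fun y hy h1 h2 => ?_⟩, hxs, hxg, hmin p hp rfl rfl⟩
  · rcases h with ⟨y, hy, h1, h2⟩ | ⟨y, hy, h1, h2⟩
    · exact Or.inl ⟨y, hy, h1.trans hxs.symm, h2.trans_eq hxg.symm⟩
    · exact Or.inr ⟨y, hy, h1.trans hxs.symm, hxg.trans_lt h2⟩
  · exact hmin y hy (h1.trans hxs) (h2.trans hxg)

theorem contraction_subset : contraction sym grp P ⊆ P := Finset.filter_subset _ _

theorem eq_of_mem_contraction {x y : ι} (hx : x ∈ contraction sym grp P)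
    (hy : y ∈ contraction sym grp P) (hs : sym x = sym y) (hg : grp x = grp y) : x = y := by
  obtain ⟨hx1, -, hx2⟩ := Finset.mem_filter.1 hx
  obtain ⟨hy1, -, hy2⟩ := Finset.mem_filter.1 hy
  exact le_antisymm (hx2 y hy1 hs.symm hg.symm) (hy2 x hx1 hs hg)

/-- A next occurrence in another group is the first one in that group. -/
theorem mem_contraction_of_next (hg : Monotone grp) {p p' : ι} (hp : p ∈ P) (hp' : p' ∈ P)
    (hs : sym p' = sym p) (hlt : grp p < grp p')
    (hnext : ∀ x ∈ P, sym x = sym p → p < x → p' ≤ x) : p' ∈ contraction sym grp P := by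
  refine Finset.mem_filter.2 ⟨hp', Or.inl ⟨p, hp, hs.symm, hlt⟩, fun x hx h1 h2 => ?_⟩
  exact hnext x hx (h1.trans hs) (lt_of_monotone_lt hg (h2 ▸ hlt))

/-- Such a jump is the last occurrence of its symbol in its group, so the pair (group, symbol)
determines it. Its next occurrence is in another group; both separations drop by `V`, or the one
from the first occurrence becomes zero, and the comparison survives contraction. -/
theorem card_filter_jumps_le (hg : Monotone grp) {σ : ι → ι → ℕ} {τ : κ → κ → ℕ} {V e : ℕ}
    (hτ : ∀ q, τ q q = 0)
    (hdiff : ∀ x ∈ P, ∀ y ∈ P, grp x ≠ grp y →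
      σ x y = V + τ (grp x) (grp y) ∧ 1 ≤ τ (grp x) (grp y)) :
    ((jumps sym σ e P).filter fun p => ¬ ∃ x ∈ P, sym x = sym p ∧ p < x ∧ grp x = grp p).card ≤
      (jumps sym (fun x y => τ (grp x) (grp y)) e (contraction sym grp P)).card := by
  refine le_trans ?_ (Finset.card_image_le (f := fun p => (grp p, sym p)))
  refine Finset.card_le_card_of_injOn (fun p => (grp p, sym p)) (fun p hp => ?_)
    fun p hp q hq hpq => ?_
  · obtain ⟨hp1, hD⟩ := Finset.mem_filter.1 hp
    obtain ⟨hpP, f, hf, p', hp', hfs, hps, hfirst, hlt, hnext, hσ⟩ := Finset.mem_filter.1 hp1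
    have hgne : grp p ≠ grp p' := fun h => hD ⟨p', hp', hps, hlt, h.symm⟩
    have hglt : grp p < grp p' := lt_of_le_of_ne (hg hlt.le) hgne
    obtain ⟨x, hx, hxs, hxg, hxp⟩ := exists_mem_contraction (P := P) (sym := sym) (grp := grp) hpP
      (Or.inr ⟨p', hp', hps, hglt⟩)
    have hp'C := mem_contraction_of_next hg hpP hp' hps hglt hnext
    have hfC : f ∈ contraction sym grp P := by
      refine Finset.mem_filter.2 ⟨hf, Or.inr ⟨p', hp', hps.trans hfs.symm, ?_⟩,
        fun y hy h1 _ => hfirst y hy (h1.trans hfs)⟩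
      exact (hg (hfirst p hpP rfl)).trans_lt hglt
    refine Finset.mem_coe.2 (Finset.mem_image.2 ⟨x, Finset.mem_filter.2 ⟨hx, ?_⟩, by
      simp [hxs, hxg]⟩)
    refine ⟨f, hfC, p', hp'C, hfs.trans hxs.symm, hps.trans hxs.symm,
      fun y hy h => hfirst y (contraction_subset hy) (h.trans hxs), hxp.trans_lt hlt,
      fun y hy h1 h2 => ?_, ?_⟩
    · refine hnext y (contraction_subset hy) (h1.trans hxs) ?_
      have : grp x ≠ grp y := fun h => h2.ne (eq_of_mem_contraction hx hy h1.symm h)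
      exact lt_of_monotone_lt hg (hxg ▸ lt_of_le_of_ne (hg h2.le) this)
    · simp only [hxg]
      obtain ⟨h1, h2⟩ := hdiff p hpP p' hp' hgne
      by_cases hfp : grp f = grp p
      · rw [hfp, hτ]
        lia
      · obtain ⟨h3, h4⟩ := hdiff f hf p hpP hfp
        lia
  · obtain ⟨hp1, hDp⟩ := Finset.mem_filter.1 hp
    obtain ⟨hq1, hDq⟩ := Finset.mem_filter.1 hq
    simp only [Prod.mk.injEq] at hpq
    have hpP := (Finset.mem_filter.1 hp1).1
    have hqP := (Finset.mem_filter.1 hq1).1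
    rcases lt_trichotomy p q with h | h | h
    · exact absurd ⟨q, hqP, hpq.2.symm, h, hpq.1.symm⟩ hDp
    · exact h
    · exact absurd ⟨p, hpP, hpq.2, h, hpq.1⟩ hDq

/-- The jumps of a sequence come from those of its contraction and of the parts of its groups. -/
theorem card_jumps_le (hg : Monotone grp) {σ : ι → ι → ℕ} {τ : κ → κ → ℕ} {V e : ℕ} (he : e ≤ 1)
    (hτ : ∀ q, τ q q = 0) (hsame : ∀ x ∈ P, ∀ y ∈ P, grp x = grp y → σ x y ≤ V)
    (hdiff : ∀ x ∈ P, ∀ y ∈ P, grp x ≠ grp y →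
      σ x y = V + τ (grp x) (grp y) ∧ 1 ≤ τ (grp x) (grp y))
    (G : Finset κ) (hG : ∀ p ∈ P, grp p ∈ G) :
    (jumps sym σ e P).card ≤
      (jumps sym (fun x y => τ (grp x) (grp y)) e (contraction sym grp P)).card +
      (∑ q ∈ G, (jumps sym σ e ((locPart sym grp P).filter fun p => grp p = q)).card +
        ∑ q ∈ G, (jumps sym σ e ((fstPart sym grp P).filter fun p => grp p = q)).card) := by
  rw [← Finset.card_filter_add_card_filter_not (s := jumps sym σ e P)
    (fun p => ∃ x ∈ P, sym x = sym p ∧ p < x ∧ grp x = grp p), add_comm]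
  refine add_le_add (card_filter_jumps_le hg hτ hdiff) ?_
  refine le_trans (Finset.card_le_card ?_) ((Finset.card_union_le
    (G.biUnion fun q => jumps sym σ e ((locPart sym grp P).filter fun p => grp p = q))
    (G.biUnion fun q => jumps sym σ e ((fstPart sym grp P).filter fun p => grp p = q))).trans
    (add_le_add Finset.card_biUnion_le Finset.card_biUnion_le))
  intro p hp
  obtain ⟨hp1, x, hx, hxs, hpx, hxg⟩ := Finset.mem_filter.1 hp
  obtain ⟨hpP, f, hf, p', hp', hfs, hps, hfirst, hlt, hnext, hσ⟩ := Finset.mem_filter.1 hp1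
  have hgp' : grp p' = grp p :=
    le_antisymm (hxg ▸ hg (hnext x hx hxs hpx)) (hg hlt.le)
  -- A first occurrence in another group would have separation at least `V + 1` from `p`, whereas
  -- the next one is within `V`. A tolerance of at most one cannot bridge the gap.
  have hgf : grp f = grp p := by
    by_contra hne
    obtain ⟨h1, h2⟩ := hdiff f hf p hpP hne
    have := hsame p hpP p' hp' hgp'.symm
    lia
  have hB : ∀ y, sym y = sym p → grp y = grp p → ¬ HasBefore sym grp P y := by
    rintro y hys hyg ⟨z, hz, hzs, hzg⟩
    exact absurd (hg (hfirst z hz (hzs.trans hys))) (not_le.2 (by rw [hgf, ← hyg]; exact hzg))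
  have hA : ∀ y, sym y = sym p → grp y = grp p →
      (HasAfter sym grp P y ↔ HasAfter sym grp P p) := by
    intro y hys hyg
    simp only [HasAfter, hys, hyg]
  rw [Finset.mem_union, Finset.mem_biUnion, Finset.mem_biUnion]
  have key : ∀ Q ⊆ P, (∀ y ∈ P, sym y = sym p → grp y = grp p → y ∈ Q) →
      p ∈ jumps sym σ e (Q.filter fun y => grp y = grp p) := by
    intro Q hQ hmem
    have hm : ∀ y ∈ P, sym y = sym p → grp y = grp p → y ∈ Q.filter fun y => grp y = grp p :=
      fun y hy h1 h2 => Finset.mem_filter.2 ⟨hmem y hy h1 h2, h2⟩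
    have hs : ∀ y ∈ Q.filter fun y => grp y = grp p, y ∈ P :=
      fun y hy => hQ (Finset.mem_filter.1 hy).1
    exact Finset.mem_filter.2 ⟨hm p hpP rfl rfl, f, hm f hf hfs hgf, p', hm p' hp' hps hgp', hfs,
      hps, fun y hy => hfirst y (hs y hy), hlt, fun y hy => hnext y (hs y hy), hσ⟩
  by_cases hAp : HasAfter sym grp P p
  · refine Or.inr ⟨grp p, hG p hpP, key _ (Finset.filter_subset _ _) fun y hy h1 h2 => ?_⟩
    exact Finset.mem_filter.2 ⟨hy, hB y h1 h2, (hA y h1 h2).2 hAp⟩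
  · refine Or.inl ⟨grp p, hG p hpP, key _ (Finset.filter_subset _ _) fun y hy h1 h2 => ?_⟩
    exact Finset.mem_filter.2 ⟨hy, hB y h1 h2, fun h => hAp ((hA y h1 h2).1 h)⟩

theorem card_eq_parts : P.card = (locPart sym grp P).card + (fstPart sym grp P).card +
    ((lstPart sym grp P).card + (midPart sym grp P).card) := by
  rw [← Finset.card_filter_add_card_filter_not (s := P) (HasBefore sym grp P),
    ← Finset.card_filter_add_card_filter_not (s := P.filter (HasBefore sym grp P))
      (HasAfter sym grp P),
    ← Finset.card_filter_add_card_filter_not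
      (s := P.filter fun p => ¬ HasBefore sym grp P p) (HasAfter sym grp P)]
  simp only [Finset.filter_filter, locPart, fstPart, lstPart, midPart]
  rw [Finset.filter_congr (s := P) (p := fun p => HasBefore sym grp P p ∧ ¬ HasAfter sym grp P p)
    (q := fun p => ¬ HasAfter sym grp P p ∧ HasBefore sym grp P p) fun p _ => and_comm]
  lia

/-! ### Counting pairs of a group and a symbol -/

section Pairs

variable {Q : Finset ι}

theorem card_image_pair_le (h : ∀ x ∈ Q, ∀ y ∈ Q, sym x = sym y → grp x = grp y) :
    (Q.image fun p => (grp p, sym p)).card ≤ numSym sym Q := by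
  refine Finset.card_le_card_of_injOn Prod.snd (fun z hz => ?_) fun z hz w hw hzw => ?_
  · obtain ⟨p, hp, rfl⟩ := Finset.mem_image.1 hz
    exact Finset.mem_coe.2 (Finset.mem_image_of_mem _ hp)
  · obtain ⟨p, hp, rfl⟩ := Finset.mem_image.1 hz
    obtain ⟨q, hq, rfl⟩ := Finset.mem_image.1 hw
    exact Prod.ext (h p hp q hq hzw) hzw

theorem grp_eq_of_not_hasBefore (hQ : Q ⊆ P) (h : ∀ x ∈ Q, ¬ HasBefore sym grp P x) :
    ∀ x ∈ Q, ∀ y ∈ Q, sym x = sym y → grp x = grp y := by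
  intro x hx y hy hxy
  rcases lt_trichotomy (grp x) (grp y) with h1 | h1 | h1
  · exact absurd ⟨x, hQ hx, hxy, h1⟩ (h y hy)
  · exact h1
  · exact absurd ⟨y, hQ hy, hxy.symm, h1⟩ (h x hx)

theorem card_image_pair_fstPart_le :
    ((fstPart sym grp P).image fun p => (grp p, sym p)).card ≤
      numSym sym (contraction sym grp P) := by
  refine (card_image_pair_le (grp_eq_of_not_hasBefore (Finset.filter_subset _ _)
    fun x hx => (Finset.mem_filter.1 hx).2.1)).trans (Finset.card_le_card fun z hz => ?_)
  obtain ⟨p, hp, rfl⟩ := Finset.mem_image.1 hz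
  obtain ⟨hpP, -, hA⟩ := Finset.mem_filter.1 hp
  obtain ⟨x, hx, hxs, -⟩ := exists_mem_contraction hpP (Or.inr hA)
  exact Finset.mem_image.2 ⟨x, hx, hxs⟩

theorem card_image_pair_midPart_le :
    ((midPart sym grp P).image fun p => (grp p, sym p)).card ≤ (contraction sym grp P).card := by
  refine le_trans (Finset.card_le_card fun z hz => ?_)
    (Finset.card_image_le (s := contraction sym grp P) (f := fun p => (grp p, sym p)))
  obtain ⟨p, hp, rfl⟩ := Finset.mem_image.1 hz
  obtain ⟨hpP, hB, -⟩ := Finset.mem_filter.1 hp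
  obtain ⟨x, hx, hxs, hxg, -⟩ := exists_mem_contraction hpP (Or.inl hB)
  exact Finset.mem_image.2 ⟨x, hx, by rw [hxs, hxg]⟩

/-- Local symbols do not occur in the contraction. The share of `n` belonging to the contracted
symbols is thus free to pay for the first, last and middle parts. -/
theorem numSym_loc_add_contraction_le :
    ((locPart sym grp P).image fun p => (grp p, sym p)).card +
      numSym sym (contraction sym grp P) ≤ numSym sym P := by
  refine (add_le_add_left (card_image_pair_le (grp_eq_of_not_hasBefore (Finset.filter_subset _ _)
    fun x hx => (Finset.mem_filter.1 hx).2.1)) _).trans ?_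
  rw [numSym, numSym, ← Finset.card_union_of_disjoint]
  · exact Finset.card_le_card (Finset.union_subset
      (Finset.image_subset_image (Finset.filter_subset _ _))
      (Finset.image_subset_image contraction_subset))
  · rw [Finset.disjoint_left]
    intro a ha hb
    obtain ⟨x, hx, rfl⟩ := Finset.mem_image.1 ha
    obtain ⟨y, hy, hyx⟩ := Finset.mem_image.1 hb
    obtain ⟨hxP, hB, hA⟩ := Finset.mem_filter.1 hx
    obtain ⟨hyP, h, -⟩ := Finset.mem_filter.1 hy
    have hg : ∀ z ∈ P, sym z = sym x → grp z = grp x := by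
      intro z hz hzs
      rcases lt_trichotomy (grp z) (grp x) with h1 | h1 | h1
      · exact absurd ⟨z, hz, hzs, h1⟩ hB
      · exact h1
      · exact absurd ⟨z, hz, hzs, h1⟩ hA
    rcases h with ⟨z, hz, hzs, hzg⟩ | ⟨z, hz, hzs, hzg⟩ <;>
    · rw [hg z hz (hzs.trans hyx), hg y hyP hyx] at hzg
      exact lt_irrefl _ hzg

end Pairs

end Grouping

/-- Length bounds for the groups of `Q` add up. -/
theorem card_le_of_groups {ι : Type*} {sym grp : ι → ℕ} {Q : Finset ι} {k c d m : ℕ} {μ : ℕ → ℕ}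
    (X : ℕ → ℕ) (hk : ∀ p ∈ Q, grp p < k) (hμ : ∑ q ∈ Finset.range k, μ q ≤ m)
    (h : ∀ q < k, X q ≤ c * numSym sym (Q.filter fun p => grp p = q) + d * μ q) :
    ∑ q ∈ Finset.range k, X q ≤ c * (Q.image fun p => (grp p, sym p)).card + d * m := by
  have h1 : (Q.image fun p => (grp p, sym p)).card =
      ∑ q ∈ Finset.range k, numSym sym (Q.filter fun p => grp p = q) := by
    rw [Finset.card_eq_sum_card_fiberwise (f := Prod.fst) (t := Finset.range k)]
    · refine Finset.sum_congr rfl fun q _ => ?_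
      rw [numSym, ← Finset.card_map (s := Finset.image sym _) ⟨fun a => (q, a), Prod.mk_right_injective q⟩]
      refine congrArg Finset.card (Finset.ext fun ⟨u, a⟩ => ?_)
      simp only [Finset.mem_filter, Finset.mem_image, Finset.mem_map, Prod.mk.injEq,
        Function.Embedding.coeFn_mk]
      constructor
      · rintro ⟨⟨p, hp, rfl, rfl⟩, hu⟩
        exact ⟨sym p, ⟨p, ⟨hp, hu⟩, rfl⟩, hu.symm, rfl⟩
      · rintro ⟨_, ⟨p, ⟨hp, hpq⟩, rfl⟩, rfl, rfl⟩
        exact ⟨⟨p, hp, hpq, rfl⟩, rfl⟩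
    · intro z hz
      obtain ⟨p, hp, rfl⟩ := Finset.mem_image.1 hz
      simpa using hk p hp
  rw [h1, Finset.mul_sum]
  calc ∑ q ∈ Finset.range k, X q
      ≤ ∑ q ∈ Finset.range k, (c * numSym sym (Q.filter fun p => grp p = q) + d * μ q) :=
        Finset.sum_le_sum fun q hq => h q (Finset.mem_range.1 hq)
    _ ≤ _ := by
        rw [Finset.sum_add_distrib, ← Finset.mul_sum (f := μ)]
        exact add_le_add_right (Nat.mul_le_mul_left _ hμ) _

/-! ### Recurrences for lengths -/

/-- Blocked sequences of order `s` with `n` symbols and `m ≤ M` blocks have length at most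
`c * n + d * m`. -/
def LenBound (s c d M : ℕ) : Prop :=
  ∀ (sym b : ℕ → ℕ) (P : Finset ℕ) (m : ℕ), HasOrder sym s P → Monotone b → IsBlocked sym b P →
    (∀ p ∈ P, b p < m) → m ≤ M → P.card ≤ c * numSym sym P + d * m

theorem lenBound_one (M : ℕ) : LenBound 1 1 1 M := fun sym b P m h1 h2 h3 h4 _ => by
  simpa using card_le_of_order_one h1 h2 h3 h4

theorem lenBound_two (M : ℕ) : LenBound 2 2 1 M := fun sym b P m h1 h2 h3 h4 _ => by
  simpa using card_le_of_order_two h1 h2 h3 h4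

/-- A block contains each symbol at most once, so the length is at most `m * n`. This starts all the
recurrences. -/
theorem LenBound.of_le {c M : ℕ} (s d : ℕ) (h : M ≤ c) : LenBound s c d M :=
  fun _ _ _ _ _ _ h3 h4 hm => (h3.card_le_mul h4).trans
    ((Nat.mul_le_mul_right _ (hm.trans h)).trans (Nat.le_add_right _ _))

theorem LenBound.mono {s c d M M' : ℕ} (h : LenBound s c d M) (hM : M' ≤ M) :
    LenBound s c d M' :=
  fun sym b P m h1 h2 h3 h4 hm => h sym b P m h1 h2 h3 h4 (hm.trans hM)

/-- The number of the first `m` blocks that lie in the `q`-th group of size `g`. -/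
def groupSize (g m q : ℕ) : ℕ := min g (m - q * g)

theorem sum_groupSize_le (g m k : ℕ) : ∑ q ∈ Finset.range k, groupSize g m q ≤ m := by
  suffices h : ∑ q ∈ Finset.range k, groupSize g m q = min (k * g) m by
    rw [h]; exact min_le_right _ _
  induction k with
  | zero => simp
  | succ k ih =>
    rw [Finset.sum_range_succ, ih, groupSize, add_mul, one_mul]
    lia

/-! ### Applying bounds inside the groups -/

section Step

variable {sym b : ℕ → ℕ} {P Q : Finset ℕ} {g m q : ℕ}

theorem monotone_div (hb : Monotone b) (g : ℕ) : Monotone fun p => b p / g :=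
  fun _ _ h => Nat.div_le_div_right (hb h)

theorem group_blocks (hg : 1 ≤ g) (hb : Monotone b) (hB : IsBlocked sym b Q)
    (hm : ∀ p ∈ Q, b p < m) (q : ℕ) :
    (Monotone fun p => b p - q * g) ∧
    (IsBlocked sym (fun p => b p - q * g) (Q.filter fun p => b p / g = q)) ∧
    ∀ p ∈ Q.filter fun p => b p / g = q, b p - q * g < groupSize g m q := by
  have key : ∀ p ∈ Q.filter fun p => b p / g = q, q * g ≤ b p ∧ b p < q * g + g := by
    intro p hp
    obtain ⟨-, rfl⟩ := Finset.mem_filter.1 hp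
    exact ⟨Nat.div_mul_le_self _ _, Nat.lt_div_mul_add hg⟩
  refine ⟨fun x y h => Nat.sub_le_sub_right (hb h) _, fun x hx y hy h1 h2 => ?_, fun p hp => ?_⟩
  · have := key x hx
    have := key y hy
    refine hB x (Finset.mem_filter.1 hx).1 y (Finset.mem_filter.1 hy).1 h1 ?_
    simp only at h2
    lia
  · have := key p hp
    have := hm p (Finset.mem_filter.1 hp).1
    rw [groupSize]
    lia

theorem div_lt_ceil (hm : ∀ p ∈ P, b p < m) : ∀ p ∈ P, b p / g < (m - 1) / g + 1 :=
  fun p hp => Nat.lt_succ_of_le (Nat.div_le_div_right (Nat.le_sub_one_of_lt (hm p hp)))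

theorem LenBound.card_groups_le {s c d : ℕ} (h : LenBound s c d g) (hg : 1 ≤ g) (hb : Monotone b)
    (hB : IsBlocked sym b Q) (hm : ∀ p ∈ Q, b p < m)
    (hord : ∀ q, HasOrder sym s (Q.filter fun p => b p / g = q)) :
    Q.card ≤ c * (Q.image fun p => (b p / g, sym p)).card + d * m := by
  rw [Finset.card_eq_sum_card_fiberwise (f := fun p => b p / g)
    (t := Finset.range ((m - 1) / g + 1)) fun p hp => by simpa using div_lt_ceil hm p hp]
  refine card_le_of_groups (μ := groupSize g m) _ (div_lt_ceil hm) (sum_groupSize_le _ _ _)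
    fun q _ => ?_
  obtain ⟨h1, h2, h3⟩ := group_blocks hg hb hB hm q
  exact h sym _ _ _ (hord q) h1 h2 h3 (min_le_left _ _)

theorem hasOrder_fst {s : ℕ} (h : HasOrder sym (s + 1) P) (hb : Monotone b) (q : ℕ) :
    HasOrder sym s ((fstPart sym (fun p => b p / g) P).filter fun p => b p / g = q) := by
  refine h.of_after (fun x hx => (Finset.mem_filter.1 (Finset.mem_filter.1 hx).1).1)
    fun x hx => ?_
  obtain ⟨hx1, hxq⟩ := Finset.mem_filter.1 hx
  obtain ⟨-, -, p, hp, hps, hpg⟩ := Finset.mem_filter.1 hx1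
  refine ⟨p, hp, hps, fun y hy => lt_of_monotone_lt (monotone_div hb g) ?_⟩
  simpa [(Finset.mem_filter.1 hy).2, ← hxq] using hpg

theorem hasOrder_lst {s : ℕ} (h : HasOrder sym (s + 1) P) (hb : Monotone b) (q : ℕ) :
    HasOrder sym s ((lstPart sym (fun p => b p / g) P).filter fun p => b p / g = q) := by
  refine h.of_before (fun x hx => (Finset.mem_filter.1 (Finset.mem_filter.1 hx).1).1)
    fun x hx => ?_
  obtain ⟨hx1, hxq⟩ := Finset.mem_filter.1 hx
  obtain ⟨-, -, p, hp, hps, hpg⟩ := Finset.mem_filter.1 hx1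
  refine ⟨p, hp, hps, fun y hy => lt_of_monotone_lt (monotone_div hb g) ?_⟩
  simpa [(Finset.mem_filter.1 hy).2, ← hxq] using hpg

theorem exists_before_of_mid (hb : Monotone b) {Q : Finset ℕ}
    (hQ : Q ⊆ (midPart sym (fun p => b p / g) P).filter fun p => b p / g = q) :
    ∀ x ∈ Q, ∃ p ∈ P, sym p = sym x ∧ ∀ y ∈ Q, p < y := by
  intro x hx
  obtain ⟨hx1, hxq⟩ := Finset.mem_filter.1 (hQ hx)
  obtain ⟨-, ⟨p, hp, hps, hpg⟩, -⟩ := Finset.mem_filter.1 hx1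
  refine ⟨p, hp, hps, fun y hy => lt_of_monotone_lt (monotone_div hb g) ?_⟩
  simpa [(Finset.mem_filter.1 (hQ hy)).2, ← hxq] using hpg

theorem exists_after_of_mid (hb : Monotone b) {Q : Finset ℕ}
    (hQ : Q ⊆ (midPart sym (fun p => b p / g) P).filter fun p => b p / g = q) :
    ∀ x ∈ Q, ∃ p ∈ P, sym p = sym x ∧ ∀ y ∈ Q, y < p := by
  intro x hx
  obtain ⟨hx1, hxq⟩ := Finset.mem_filter.1 (hQ hx)
  obtain ⟨-, -, p, hp, hps, hpg⟩ := Finset.mem_filter.1 hx1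
  refine ⟨p, hp, hps, fun y hy => lt_of_monotone_lt (monotone_div hb g) ?_⟩
  simpa [(Finset.mem_filter.1 (hQ hy)).2, ← hxq] using hpg

/-- A middle symbol occurs both in an earlier and in a later group, so an alternation inside the
group extends at both ends. -/
theorem hasOrder_mid {s : ℕ} (h : HasOrder sym (s + 2) P) (hb : Monotone b) (q : ℕ) :
    HasOrder sym s ((midPart sym (fun p => b p / g) P).filter fun p => b p / g = q) :=
  h.of_before_after (fun _ hx => (Finset.mem_filter.1 (Finset.mem_filter.1 hx).1).1)
    (exists_before_of_mid hb subset_rfl) (exists_after_of_mid hb subset_rfl)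

theorem card_image_pair_lstPart_le {grp : ℕ → ℕ} :
    ((lstPart sym grp P).image fun p => (grp p, sym p)).card ≤
      numSym sym (contraction sym grp P) := by
  refine (card_image_pair_le fun x hx y hy hxy => ?_).trans (Finset.card_le_card fun z hz => ?_)
  · obtain ⟨hx1, hx2, -⟩ := Finset.mem_filter.1 hx
    obtain ⟨hy1, hy2, -⟩ := Finset.mem_filter.1 hy
    rcases lt_trichotomy (grp x) (grp y) with h1 | h1 | h1
    · exact absurd ⟨y, hy1, hxy.symm, h1⟩ hx2
    · exact h1
    · exact absurd ⟨x, hx1, hxy, h1⟩ hy2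
  · obtain ⟨p, hp, rfl⟩ := Finset.mem_image.1 hz
    obtain ⟨hpP, -, hB⟩ := Finset.mem_filter.1 hp
    obtain ⟨x, hx, hxs, -⟩ := exists_mem_contraction hpP (Or.inl hB)
    exact Finset.mem_image.2 ⟨x, hx, hxs⟩

/-- The length of a sequence in terms of its middle occurrences. -/
theorem card_le_add_mid {s c₀ d₀ c₁ d₁ : ℕ} (h₀ : LenBound (s + 1) c₀ d₀ g)
    (h₁ : LenBound s c₁ d₁ g) (hg : 1 ≤ g) (hP : HasOrder sym (s + 1) P) (hb : Monotone b)
    (hB : IsBlocked sym b P) (hm : ∀ p ∈ P, b p < m) :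
    P.card + c₀ * numSym sym (contraction sym (fun p => b p / g) P) ≤ c₀ * numSym sym P +
      2 * c₁ * numSym sym (contraction sym (fun p => b p / g) P) +
      (d₀ + 2 * d₁) * m + (midPart sym (fun p => b p / g) P).card := by
  have hl := h₀.card_groups_le hg hb (hB.mono (Finset.filter_subset _ _))
    (fun p hp => hm p (Finset.filter_subset _ _ hp)) (Q := locPart sym (fun p => b p / g) P)
    fun q => hP.mono ((Finset.filter_subset _ _).trans (Finset.filter_subset _ _))
  have hf := h₁.card_groups_le hg hb (hB.mono (Finset.filter_subset _ _))
    (fun p hp => hm p (Finset.filter_subset _ _ hp)) (Q := fstPart sym (fun p => b p / g) P)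
    (hasOrder_fst hP hb)
  have ht := h₁.card_groups_le hg hb (hB.mono (Finset.filter_subset _ _))
    (fun p hp => hm p (Finset.filter_subset _ _ hp)) (Q := lstPart sym (fun p => b p / g) P)
    (hasOrder_lst hP hb)
  have hf' := Nat.mul_le_mul_left c₁
    (card_image_pair_fstPart_le (sym := sym) (grp := fun p => b p / g) (P := P))
  have ht' := Nat.mul_le_mul_left c₁
    (card_image_pair_lstPart_le (sym := sym) (grp := fun p => b p / g) (P := P))
  -- The local part has at most `n - N` symbols, with `N` those of the contraction; the term `c₀ *
  -- N` stands on the left of the goal to avoid subtraction.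
  have hn := Nat.mul_le_mul_left c₀
    (numSym_loc_add_contraction_le (sym := sym) (grp := fun p => b p / g) (P := P))
  rw [card_eq_parts (sym := sym) (grp := fun p => b p / g) (P := P)]
  linarith

theorem contraction_blocks {grp : ℕ → ℕ} : IsBlocked sym grp (contraction sym grp P) :=
  fun _ hx _ hy hs hg => eq_of_mem_contraction hx hy hs hg

/-- The number of groups is at most `M'`, and small compared to the number of blocks. -/
theorem ceil_groups {M' X : ℕ} (hg : 1 ≤ g) (hgm : g < m) (hm : m ≤ g * M') (hX : 2 * X ≤ g) :
    (m - 1) / g + 1 ≤ M' ∧ X * ((m - 1) / g + 1) ≤ m := by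
  refine ⟨?_, ?_⟩
  · rw [Nat.succ_le_iff, Nat.div_lt_iff_lt_mul hg, mul_comm]
    lia
  · have h1 := Nat.div_mul_le_self (m - 1) g
    have h2 : 2 * X * ((m - 1) / g + 1) ≤ g * ((m - 1) / g + 1) := Nat.mul_le_mul_right _ hX
    have h3 : g * ((m - 1) / g + 1) = (m - 1) / g * g + g := by ring
    have h4 : 2 * (X * ((m - 1) / g + 1)) ≤ 2 * m := by rw [← mul_assoc]; lia
    lia

end Step

/-- The basic recurrence. -/
theorem LenBound.step {s c₀ d₀ c₁ d₁ c₂ d₂ c₃ d₃ d g M' : ℕ} (h₀ : LenBound (s + 2) c₀ d₀ g)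
    (h₁ : LenBound (s + 1) c₁ d₁ g) (h₂ : LenBound s c₂ d₂ g) (h₃ : LenBound (s + 2) c₃ d₃ M')
    (hg : 1 ≤ g) (hgd : 2 * (c₂ * d₃) ≤ g) (hc : 2 * c₁ + c₂ * c₃ ≤ c₀)
    (hd : d₀ + 2 * d₁ + d₂ + 1 ≤ d) : LenBound (s + 2) c₀ d (g * M') := by
  intro sym b P m hP hb hB hm hmM
  by_cases hmg : m ≤ g
  · exact (h₀ sym b P m hP hb hB hm hmg).trans
      (Nat.add_le_add_left (Nat.mul_le_mul_right _ (by lia)) _)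
  obtain ⟨hk, hX⟩ := ceil_groups hg (not_le.1 hmg) hmM hgd
  have hstep := card_le_add_mid (s := s + 1) h₀ h₁ hg hP hb hB hm
  have hmid := h₂.card_groups_le hg hb (hB.mono (Finset.filter_subset _ _))
    (fun p hp => hm p (Finset.filter_subset _ _ hp)) (Q := midPart sym (fun p => b p / g) P)
    (hasOrder_mid hP hb)
  have hcon := h₃ sym _ _ _ (hP.mono contraction_subset) (monotone_div hb g) contraction_blocks
    (fun p hp => div_lt_ceil hm p (contraction_subset hp)) hk
  have hpair := card_image_pair_midPart_le (sym := sym) (grp := fun p => b p / g) (P := P)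
  -- The contraction's contribution `c₂ * d₃` per group sums to at most `m` by `hX`, which is the `+
  -- 1` in `hd`.
  have h1 := Nat.mul_le_mul_left c₂ (hpair.trans hcon)
  have h2 := Nat.mul_le_mul_right m hd
  have h3 := Nat.mul_le_mul_right (numSym sym (contraction sym (fun p => b p / g) P)) hc
  nlinarith

/-! ### Recurrences for jumps -/

/-- The largest rank of a boundary between the blocks `x` and `y`. -/
def sep (r : ℕ → ℕ) (x y : ℕ) : ℕ := (Finset.Ioc (min x y) (max x y)).sup r

theorem sep_comm (r : ℕ → ℕ) (x y : ℕ) : sep r x y = sep r y x := by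
  rw [sep, sep, min_comm, max_comm]

theorem sep_self (r : ℕ → ℕ) (x : ℕ) : sep r x x = 0 := by simp [sep]

theorem sep_mono (r : ℕ → ℕ) {x y u v : ℕ} (h : x ≤ y) (hux : u ≤ x) (hyv : y ≤ v) :
    sep r x y ≤ sep r u v := by
  rw [sep, sep, min_eq_left h, max_eq_right h, min_eq_left (hux.trans (h.trans hyv)),
    max_eq_right (hux.trans (h.trans hyv))]
  exact Finset.sup_mono (Finset.Ioc_subset_Ioc hux hyv)

/-- The rank for which the groups of size `g` are separated by `t` and subdivided by `s`. -/
def glue (g : ℕ) (s t : ℕ → ℕ) (x : ℕ) : ℕ :=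
  if g ∣ x then (Finset.range g).sup s + t (x / g) else s (x % g)

section Glue

variable {g : ℕ} {s t : ℕ → ℕ} {x y : ℕ}

theorem sep_glue_same (h : x / g = y / g) (hg : 1 ≤ g) :
    sep (glue g s t) x y = sep s (x - x / g * g) (y - x / g * g) ∧
      sep (glue g s t) x y ≤ (Finset.range g).sup s := by
  wlog hxy : x ≤ y generalizing x y
  · have := this h.symm (le_of_not_ge hxy)
    rwa [sep_comm, sep_comm s, ← h] at this
  have hx := Nat.div_mul_le_self x g
  have hy : y < x / g * g + g := h ▸ Nat.lt_div_mul_add hg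
  have key : ∀ z ∈ Finset.Ioc x y, glue g s t z = s (z - x / g * g) ∧ z - x / g * g < g := by
    intro z hz
    rw [Finset.mem_Ioc] at hz
    have hz1 : z - x / g * g < g := by lia
    have hz2 : z % g = z - x / g * g := by
      conv_lhs => rw [show z = z - x / g * g + x / g * g by lia]
      rw [Nat.add_mul_mod_self_right, Nat.mod_eq_of_lt hz1]
    refine ⟨?_, hz1⟩
    rw [glue, if_neg, hz2]
    rw [Nat.dvd_iff_mod_eq_zero]
    lia
  rw [sep, sep, min_eq_left hxy, max_eq_right hxy, min_eq_left (by lia), max_eq_right (by lia)]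
  refine ⟨le_antisymm (Finset.sup_le fun z hz => ?_) (Finset.sup_le fun z hz => ?_),
    Finset.sup_le fun z hz => ?_⟩
  · rw [(key z hz).1]
    rw [Finset.mem_Ioc] at hz
    exact Finset.le_sup (f := s) (Finset.mem_Ioc.2 (by lia))
  · rw [Finset.mem_Ioc] at hz
    have hz' : z + x / g * g ∈ Finset.Ioc x y := Finset.mem_Ioc.2 (by lia)
    have := (key _ hz').1
    rw [Nat.add_sub_cancel] at this
    rw [← this]
    exact Finset.le_sup (f := glue g s t) hz'
  · rw [(key z hz).1]
    exact Finset.le_sup (f := s) (Finset.mem_range.2 (key z hz).2)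

/-- Any group boundary outranks all inner boundaries, whose ranks are at most the supremum of `s`.
Between different groups only the ranks `t` of the group boundaries decide, and `1 ≤ t` makes this
strict. -/
theorem sep_glue_ne (h : x / g ≠ y / g) (hg : 1 ≤ g) (ht : ∀ z, 1 ≤ t z) :
    sep (glue g s t) x y = (Finset.range g).sup s + sep t (x / g) (y / g) ∧
      1 ≤ sep t (x / g) (y / g) := by
  wlog hxy : x ≤ y generalizing x y
  · have := this h.symm (le_of_not_ge hxy)
    rwa [sep_comm, sep_comm t] at this
  have hlt : x / g < y / g := lt_of_le_of_ne (Nat.div_le_div_right hxy) h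
  rw [sep, sep, min_eq_left hxy, max_eq_right hxy, min_eq_left hlt.le, max_eq_right hlt.le]
  refine ⟨le_antisymm (Finset.sup_le fun z hz => ?_) ?_, ?_⟩
  · rw [Finset.mem_Ioc] at hz
    rw [glue]
    split_ifs with hd
    · obtain ⟨w, rfl⟩ := hd
      rw [Nat.mul_div_cancel_left _ hg]
      refine Nat.add_le_add_left (Finset.le_sup (f := t) (Finset.mem_Ioc.2 ⟨?_, ?_⟩)) _
      · rw [Nat.div_lt_iff_lt_mul hg, mul_comm]
        exact hz.1
      · rw [Nat.le_div_iff_mul_le hg, mul_comm]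
        exact hz.2
    · exact (Finset.le_sup (f := s) (Finset.mem_range.2 (Nat.mod_lt _ hg))).trans
        (Nat.le_add_right _ _)
  · obtain ⟨z, hz, hz'⟩ := Finset.exists_mem_eq_sup (Finset.Ioc (x / g) (y / g))
      ⟨y / g, Finset.mem_Ioc.2 ⟨hlt, le_rfl⟩⟩ t
    rw [hz']
    rw [Finset.mem_Ioc] at hz
    have hgz : glue g s t (z * g) = (Finset.range g).sup s + t z := by
      rw [glue, if_pos (Dvd.intro_left _ rfl), Nat.mul_div_cancel _ hg]
    rw [← hgz]
    refine Finset.le_sup (f := glue g s t) (Finset.mem_Ioc.2 ⟨?_, ?_⟩)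
    · exact (Nat.div_lt_iff_lt_mul hg).1 hz.1
    · exact (Nat.le_div_iff_mul_le hg).1 hz.2
  · exact (ht (y / g)).trans (Finset.le_sup (f := t) (Finset.mem_Ioc.2 ⟨hlt, le_rfl⟩))

end Glue

/-- The jumps of the reversed sequence. -/
def revJumps (sym : ℕ → ℕ) (σ : ℕ → ℕ → ℕ) (e : ℕ) (P : Finset ℕ) : Finset ℕ :=
  jumps (ι := ℕᵒᵈ) sym σ e P

/-- With the rank `r` of the boundaries, blocked sequences of order `s` with `n` symbols and
`m ≤ M` blocks have at most `c * n + d * m` jumps in each direction. -/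
def JumpBound (r : ℕ → ℕ) (s c d M : ℕ) : Prop :=
  ∀ (sym b : ℕ → ℕ) (P : Finset ℕ) (m : ℕ), HasOrder sym s P → Monotone b → IsBlocked sym b P →
    (∀ p ∈ P, b p < m) → m ≤ M →
    (jumps sym (fun x y => sep r (b x) (b y)) 0 P).card ≤ c * numSym sym P + d * m ∧
    (revJumps sym (fun x y => sep r (b x) (b y)) 1 P).card ≤ c * numSym sym P + d * m

theorem LenBound.jumpBound {s c d M : ℕ} (h : LenBound s c d M) (r : ℕ → ℕ) :
    JumpBound r s c d M := fun sym b P m h1 h2 h3 h4 hm =>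
  ⟨(Finset.card_le_card (Finset.filter_subset _ _)).trans (h sym b P m h1 h2 h3 h4 hm),
    (Finset.card_le_card (Finset.filter_subset (α := ℕᵒᵈ) _ _)).trans
      (h sym b P m h1 h2 h3 h4 hm)⟩

theorem JumpBound.mono {r : ℕ → ℕ} {s c d M M' : ℕ} (h : JumpBound r s c d M) (hM : M' ≤ M) :
    JumpBound r s c d M' :=
  fun sym b P m h1 h2 h3 h4 hm => h sym b P m h1 h2 h3 h4 (hm.trans hM)

/-- The last occurrence in each group of every symbol that is not confined to one group. -/
def revContraction (sym grp : ℕ → ℕ) (P : Finset ℕ) : Finset ℕ :=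
  contraction (ι := ℕᵒᵈ) (κ := ℕᵒᵈ) sym grp P

/-! ### Reversal through the order dual, exchanging first and last parts -/

section Reverse

variable {sym grp : ℕ → ℕ} {P : Finset ℕ}

theorem revContraction_subset : revContraction sym grp P ⊆ P :=
  contraction_subset (ι := ℕᵒᵈ) (κ := ℕᵒᵈ)

theorem revContraction_blocks : IsBlocked sym grp (revContraction sym grp P) :=
  fun _ hx _ hy hs hg => eq_of_mem_contraction (ι := ℕᵒᵈ) (κ := ℕᵒᵈ) hx hy hs hg

theorem monotone_dual (hg : Monotone grp) :
    Monotone (α := ℕᵒᵈ) (β := ℕᵒᵈ) grp := fun _ _ h => hg h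

theorem locPart_dual : locPart (ι := ℕᵒᵈ) (κ := ℕᵒᵈ) sym grp P = locPart sym grp P := by
  ext p
  constructor <;> intro h
  · obtain ⟨h1, h2, h3⟩ := (mem_locPart (ι := ℕᵒᵈ) (κ := ℕᵒᵈ)).1 h
    exact mem_locPart.2 ⟨h1, h3, h2⟩
  · obtain ⟨h1, h2, h3⟩ := mem_locPart.1 h
    exact (mem_locPart (ι := ℕᵒᵈ) (κ := ℕᵒᵈ)).2 ⟨h1, h3, h2⟩

theorem fstPart_dual : fstPart (ι := ℕᵒᵈ) (κ := ℕᵒᵈ) sym grp P = lstPart sym grp P := rfl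

theorem card_image_pair_lstPart_le_rev :
    ((lstPart sym grp P).image fun p => (grp p, sym p)).card ≤
      numSym sym (revContraction sym grp P) :=
  card_image_pair_fstPart_le (ι := ℕᵒᵈ) (κ := ℕᵒᵈ)

theorem numSym_loc_add_revContraction_le :
    ((locPart sym grp P).image fun p => (grp p, sym p)).card +
      numSym sym (revContraction sym grp P) ≤ numSym sym P := by
  have := numSym_loc_add_contraction_le (ι := ℕᵒᵈ) (κ := ℕᵒᵈ) (sym := sym) (grp := grp) (P := P)
  rw [locPart_dual] at this
  exact this

theorem numSym_revContraction_le :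
    numSym sym (revContraction sym grp P) ≤ numSym sym (contraction sym grp P) := by
  refine Finset.card_le_card fun z hz => ?_
  obtain ⟨p, hp, rfl⟩ := Finset.mem_image.1 hz
  obtain ⟨hpP, h, -⟩ := (mem_contraction (ι := ℕᵒᵈ) (κ := ℕᵒᵈ)).1 hp
  obtain ⟨x, hx, hxs, -⟩ := exists_mem_contraction (sym := sym) (grp := grp) hpP h.symm
  exact Finset.mem_image.2 ⟨x, hx, hxs⟩

theorem revJumps_congr {σ τ : ℕ → ℕ → ℕ} {e : ℕ} (h : ∀ x ∈ P, ∀ y ∈ P, σ x y = τ x y) :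
    revJumps sym σ e P = revJumps sym τ e P := jumps_congr (ι := ℕᵒᵈ) h

theorem card_revJumps_le (hg : Monotone grp) {σ τ : ℕ → ℕ → ℕ} {V e : ℕ} (he : e ≤ 1)
    (hτ : ∀ q, τ q q = 0) (hsame : ∀ x ∈ P, ∀ y ∈ P, grp x = grp y → σ x y ≤ V)
    (hdiff : ∀ x ∈ P, ∀ y ∈ P, grp x ≠ grp y →
      σ x y = V + τ (grp x) (grp y) ∧ 1 ≤ τ (grp x) (grp y))
    (G : Finset ℕ) (hG : ∀ p ∈ P, grp p ∈ G) :
    (revJumps sym σ e P).card ≤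
      (revJumps sym (fun x y => τ (grp x) (grp y)) e (revContraction sym grp P)).card +
      (∑ q ∈ G, (revJumps sym σ e ((locPart sym grp P).filter fun p => grp p = q)).card +
        ∑ q ∈ G, (revJumps sym σ e ((lstPart sym grp P).filter fun p => grp p = q)).card) := by
  have := card_jumps_le (ι := ℕᵒᵈ) (κ := ℕᵒᵈ) (sym := sym) (grp := grp) (P := P)
    (monotone_dual hg) he hτ hsame hdiff G hG
  rw [locPart_dual, fstPart_dual] at this
  exact this

end Reverse

section JumpStep

variable {sym b : ℕ → ℕ} {Q : Finset ℕ} {g m : ℕ} {s t : ℕ → ℕ}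

theorem JumpBound.sum_groups_le {o c d : ℕ} (h : JumpBound s o c d g) (hg : 1 ≤ g)
    (hb : Monotone b) (hB : IsBlocked sym b Q) (hm : ∀ p ∈ Q, b p < m)
    (hord : ∀ q, HasOrder sym o (Q.filter fun p => b p / g = q)) :
    ∑ q ∈ Finset.range ((m - 1) / g + 1),
      (jumps sym (fun x y => sep (glue g s t) (b x) (b y)) 0
        (Q.filter fun p => b p / g = q)).card ≤
      c * (Q.image fun p => (b p / g, sym p)).card + d * m ∧
    ∑ q ∈ Finset.range ((m - 1) / g + 1),
      (revJumps sym (fun x y => sep (glue g s t) (b x) (b y)) 1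
        (Q.filter fun p => b p / g = q)).card ≤
      c * (Q.image fun p => (b p / g, sym p)).card + d * m := by
  have key : ∀ q, ∀ x ∈ Q.filter fun p => b p / g = q, ∀ y ∈ Q.filter fun p => b p / g = q,
      sep (glue g s t) (b x) (b y) = sep s (b x - q * g) (b y - q * g) := by
    intro q x hx y hy
    obtain ⟨-, rfl⟩ := Finset.mem_filter.1 hx
    obtain ⟨-, hy'⟩ := Finset.mem_filter.1 hy
    exact (sep_glue_same hy'.symm hg).1
  constructor <;>
    refine card_le_of_groups (μ := groupSize g m) _ (div_lt_ceil hm) (sum_groupSize_le _ _ _)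
      fun q _ => ?_
  · obtain ⟨h1, h2, h3⟩ := group_blocks hg hb hB hm q
    rw [jumps_congr (key q)]
    exact (h sym _ _ _ (hord q) h1 h2 h3 (min_le_left _ _)).1
  · obtain ⟨h1, h2, h3⟩ := group_blocks hg hb hB hm q
    rw [revJumps_congr (key q)]
    exact (h sym _ _ _ (hord q) h1 h2 h3 (min_le_left _ _)).2

end JumpStep

/-- The recurrence for the number of jumps. -/
theorem JumpBound.step {r t : ℕ → ℕ} {s c₀ d₀ c₁ d₁ c₃ d₃ d g M' : ℕ}
    (h₀ : JumpBound r (s + 1) c₀ d₀ g) (h₁ : JumpBound r s c₁ d₁ g)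
    (h₃ : JumpBound t (s + 1) c₃ d₃ M') (ht : ∀ z, 1 ≤ t z) (hg : 1 ≤ g) (hgd : 2 * d₃ ≤ g)
    (hc : c₁ + c₃ ≤ c₀) (hd : d₀ + d₁ + 1 ≤ d) :
    JumpBound (glue g r t) (s + 1) c₀ d (g * M') := by
  intro sym b P m hP hb hB hm hmM
  have hsame : ∀ x ∈ P, ∀ y ∈ P, b x / g = b y / g →
      sep (glue g r t) (b x) (b y) ≤ (Finset.range g).sup r :=
    fun x _ y _ h => (sep_glue_same h hg).2
  have hdiff : ∀ x ∈ P, ∀ y ∈ P, b x / g ≠ b y / g →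
      sep (glue g r t) (b x) (b y) = (Finset.range g).sup r + sep t (b x / g) (b y / g) ∧
        1 ≤ sep t (b x / g) (b y / g) := fun x _ y _ h => sep_glue_ne h hg ht
  by_cases hmg : m ≤ g
  · have hσ : ∀ x ∈ P, ∀ y ∈ P, sep (glue g r t) (b x) (b y) = sep r (b x) (b y) := by
      intro x hx y hy
      have hx0 : b x / g = 0 := Nat.div_eq_of_lt ((hm x hx).trans_le hmg)
      have hy0 : b y / g = 0 := Nat.div_eq_of_lt ((hm y hy).trans_le hmg)
      have := (sep_glue_same (s := r) (t := t) (hx0.trans hy0.symm) hg).1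
      simpa [hx0] using this
    obtain ⟨hl, hr⟩ := h₀ sym b P m hP hb hB hm hmg
    have hd' : d₀ * m ≤ d * m := Nat.mul_le_mul_right _ (by lia)
    refine ⟨?_, ?_⟩
    · rw [jumps_congr hσ]
      lia
    · rw [revJumps_congr hσ]
      lia
  obtain ⟨hk, hX⟩ := ceil_groups hg (not_le.1 hmg) hmM hgd
  have hG : ∀ p ∈ P, b p / g ∈ Finset.range ((m - 1) / g + 1) :=
    fun p hp => Finset.mem_range.2 (div_lt_ceil hm p hp)
  have hloc := h₀.sum_groups_le (t := t) hg hb (hB.mono (Finset.filter_subset _ _))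
    (fun p hp => hm p (Finset.filter_subset _ _ hp)) (Q := locPart sym (fun p => b p / g) P)
    fun q => hP.mono ((Finset.filter_subset _ _).trans (Finset.filter_subset _ _))
  have h2 := Nat.mul_le_mul_right m hd
  constructor
  -- There is no term for last or middle parts, so `c₁` and `c₃` are added instead of multiplied.
  · have hstep := card_jumps_le (sym := sym) (monotone_div hb g) (Nat.zero_le 1)
      (sep_self t) hsame hdiff _ hG
    have hfst := (h₁.sum_groups_le (t := t) hg hb (hB.mono (Finset.filter_subset _ _))
      (fun p hp => hm p (Finset.filter_subset _ _ hp)) (Q := fstPart sym (fun p => b p / g) P)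
      (hasOrder_fst hP hb)).1
    have hcon := (h₃ sym _ _ _ (hP.mono contraction_subset) (monotone_div hb g)
      contraction_blocks (fun p hp => div_lt_ceil hm p (contraction_subset hp)) hk).1
    have hf := Nat.mul_le_mul_left c₁
      (card_image_pair_fstPart_le (sym := sym) (grp := fun p => b p / g) (P := P))
    have hn := Nat.mul_le_mul_left c₀
      (numSym_loc_add_contraction_le (sym := sym) (grp := fun p => b p / g) (P := P))
    have h3 := Nat.mul_le_mul_right (numSym sym (contraction sym (fun p => b p / g) P)) hc
    have h4 := hloc.1
    nlinarith
  · have hstep := card_revJumps_le (sym := sym) (monotone_div hb g) le_rfl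
      (sep_self t) hsame hdiff _ hG
    have hfst := (h₁.sum_groups_le (t := t) hg hb (hB.mono (Finset.filter_subset _ _))
      (fun p hp => hm p (Finset.filter_subset _ _ hp)) (Q := lstPart sym (fun p => b p / g) P)
      (hasOrder_lst hP hb)).2
    have hcon := (h₃ sym _ _ _ (hP.mono revContraction_subset) (monotone_div hb g)
      revContraction_blocks (fun p hp => div_lt_ceil hm p (revContraction_subset hp)) hk).2
    have hf := Nat.mul_le_mul_left c₁
      (card_image_pair_lstPart_le_rev (sym := sym) (grp := fun p => b p / g) (P := P))
    have hn := Nat.mul_le_mul_left c₀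
      (numSym_loc_add_revContraction_le (sym := sym) (grp := fun p => b p / g) (P := P))
    have h3 := Nat.mul_le_mul_right (numSym sym (revContraction sym (fun p => b p / g) P)) hc
    have h4 := hloc.2
    nlinarith

/-! ### Sequences of order five -/

/-- The separations around an occurrence that does not contract to a jump. -/
theorem exists_of_not_jump {ι κ : Type*} [LinearOrder ι] [LinearOrder κ] {sym : ι → ℕ}
    {grp : ι → κ} {P : Finset ι} (hg : Monotone grp) {τ : κ → κ → ℕ} {e : ℕ} {p : ι} (hp : p ∈ P)
    (hB : HasBefore sym grp P p) (hA : HasAfter sym grp P p)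
    (hJ : ∀ x ∈ jumps sym (fun x y => τ (grp x) (grp y)) e (contraction sym grp P),
      sym x = sym p → grp x ≠ grp p) :
    ∃ f ∈ P, ∃ p' ∈ P, sym f = sym p ∧ sym p' = sym p ∧ grp f < grp p ∧ grp p < grp p' ∧
      τ (grp p) (grp p') + e ≤ τ (grp f) (grp p) := by
  obtain ⟨x, hx, hxs, hxg, -⟩ := exists_mem_contraction hp (Or.inl hB)
  obtain ⟨u, hu, hus, hug⟩ := hB
  obtain ⟨v, hv, hvs, hvg⟩ := hA
  have hne1 : (P.filter fun y => sym y = sym p).Nonempty := ⟨p, Finset.mem_filter.2 ⟨hp, rfl⟩⟩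
  have hne2 : (P.filter fun y => sym y = sym p ∧ grp p < grp y).Nonempty :=
    ⟨v, Finset.mem_filter.2 ⟨hv, hvs, hvg⟩⟩
  obtain ⟨hf, hfs⟩ := Finset.mem_filter.1 (Finset.min'_mem _ hne1)
  obtain ⟨hp', hps, hpg⟩ := Finset.mem_filter.1 (Finset.min'_mem _ hne2)
  have hfmin : ∀ y ∈ P, sym y = sym p → Finset.min' _ hne1 ≤ y :=
    fun y hy h => Finset.min'_le _ _ (Finset.mem_filter.2 ⟨hy, h⟩)
  have hpmin : ∀ y ∈ P, sym y = sym p → grp p < grp y → Finset.min' _ hne2 ≤ y :=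
    fun y hy h h' => Finset.min'_le _ _ (Finset.mem_filter.2 ⟨hy, h, h'⟩)
  generalize Finset.min' _ hne1 = f at *
  generalize Finset.min' _ hne2 = p' at *
  have hfg : grp f < grp p := (hg (hfmin u hu hus)).trans_lt hug
  refine ⟨f, hf, p', hp', hfs, hps, hfg, hpg, ?_⟩
  -- Otherwise the representative `x` of `p` in the contraction is a jump there, with first
  -- occurrence `f` and next occurrence `p'`.
  by_contra hcon
  refine hJ x (Finset.mem_filter.2 ⟨hx, f, ?_, p', ?_, hfs.trans hxs.symm, hps.trans hxs.symm,
    fun y hy h => hfmin y (contraction_subset hy) (h.trans hxs), ?_, fun y hy h1 h2 => ?_, ?_⟩)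
    hxs hxg
  · exact Finset.mem_filter.2 ⟨hf, Or.inr ⟨p, hp, hfs.symm, hfg⟩,
      fun y hy h _ => hfmin y hy (h.trans hfs)⟩
  · exact Finset.mem_filter.2 ⟨hp', Or.inl ⟨p, hp, hps.symm, hpg⟩,
      fun y hy h h' => hpmin y hy (h.trans hps) (h' ▸ hpg)⟩
  · exact lt_of_monotone_lt hg (hxg ▸ hpg)
  · have : grp x ≠ grp y := fun h => h2.ne (eq_of_mem_contraction hx hy h1.symm h)
    exact hpmin y (contraction_subset hy) (h1.trans hxs)
      (hxg ▸ lt_of_le_of_ne (hg h2.le) this)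
  · simp only [hxg]
    exact not_le.1 hcon

/-- The middle occurrences that contract to a jump in one of the two directions. -/
def badPart (sym grp : ℕ → ℕ) (r : ℕ → ℕ) (P : Finset ℕ) : Finset ℕ :=
  (midPart sym grp P).filter fun p =>
    (∃ x ∈ jumps sym (fun x y => sep r (grp x) (grp y)) 0 (contraction sym grp P),
      sym x = sym p ∧ grp x = grp p) ∨
    (∃ x ∈ revJumps sym (fun x y => sep r (grp x) (grp y)) 1 (revContraction sym grp P),
      sym x = sym p ∧ grp x = grp p)

/-- The other middle occurrences. -/
def goodPart (sym grp : ℕ → ℕ) (r : ℕ → ℕ) (P : Finset ℕ) : Finset ℕ :=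
  (midPart sym grp P) \ badPart sym grp r P

theorem goodPart_subset {sym grp r : ℕ → ℕ} {P : Finset ℕ} :
    goodPart sym grp r P ⊆ midPart sym grp P := Finset.sdiff_subset

theorem badPart_subset {sym grp r : ℕ → ℕ} {P : Finset ℕ} :
    badPart sym grp r P ⊆ midPart sym grp P := Finset.filter_subset _ _

/-- For symbols of `x` and `y` in one group, compare the first and next occurrence `f`, `a` of the
one with the last and previous occurrence `l`, `c` of the other. Either `f < c` before the group or
`a < l` behind it, since the non-jump inequalities exclude the remaining nested position. -/
theorem hasOrder_good {sym b r : ℕ → ℕ} {P : Finset ℕ} {g : ℕ} (hP : HasOrder sym 5 P)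
    (hb : Monotone b) (q : ℕ) :
    HasOrder sym 2 ((goodPart sym (fun p => b p / g) r P).filter fun p => b p / g = q) := by
  have hg := monotone_div hb g
  have hsub : (goodPart sym (fun p => b p / g) r P).filter (fun p => b p / g = q) ⊆
      (midPart sym (fun p => b p / g) P).filter fun p => b p / g = q :=
    Finset.filter_subset_filter _ goodPart_subset
  refine hP.two_of_five (hsub.trans ((Finset.filter_subset _ _).trans (Finset.filter_subset _ _)))
    (exists_before_of_mid hb hsub) (exists_after_of_mid hb hsub) fun x hx y hy => ?_
  obtain ⟨hx1, hxq⟩ := Finset.mem_filter.1 hx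
  obtain ⟨hy1, hyq⟩ := Finset.mem_filter.1 hy
  obtain ⟨hxm, hxb⟩ := Finset.mem_sdiff.1 hx1
  obtain ⟨hym, hyb⟩ := Finset.mem_sdiff.1 hy1
  obtain ⟨hxP, hxB, hxA⟩ := Finset.mem_filter.1 hxm
  obtain ⟨hyP, hyB, hyA⟩ := Finset.mem_filter.1 hym
  obtain ⟨f, hf, a, ha, hfs, has, hfg, hag, hfa⟩ := exists_of_not_jump (sym := sym) hg
    (τ := sep r) (e := 0) hxP hxB hxA fun z hz h1 h2 =>
      hxb (Finset.mem_filter.2 ⟨hxm, Or.inl ⟨z, hz, h1, h2⟩⟩)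
  obtain ⟨l, hl, c, hc, hls, hcs, hlg, hcg, hlc⟩ := exists_of_not_jump (ι := ℕᵒᵈ) (κ := ℕᵒᵈ)
    (sym := sym) (monotone_dual hg) (τ := sep r) (e := 1) hyP hyA hyB fun z hz h1 h2 =>
      hyb (Finset.mem_filter.2 ⟨hym, Or.inr ⟨z, hz, h1, h2⟩⟩)
  change b c / g < b y / g at hcg
  change b y / g < b l / g at hlg
  change sep r (b y / g) (b c / g) + 1 ≤ sep r (b l / g) (b y / g) at hlc
  by_cases hfc : f < c
  · refine ⟨f, hf, c, hc, hfs, hcs, hfc, Or.inl fun z hz => lt_of_monotone_lt hg ?_⟩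
    simpa [(Finset.mem_filter.1 hz).2, hyq] using hcg
  by_cases hal : a < l
  · refine ⟨a, ha, l, hl, has, hls, hal, Or.inr fun z hz => lt_of_monotone_lt hg ?_⟩
    simpa [(Finset.mem_filter.1 hz).2, hxq] using hag
  exfalso
  -- Now `c` is no later than `f`, and `l` no later than `a`, up to groups. Hence sep(q,l) ≤
  -- sep(q,a) ≤ sep(f,q) ≤ sep(c,q) < sep(q,l); the last inequality is strict because the reversed
  -- jumps have tolerance one.
  rw [hxq] at hfg hag hfa
  rw [hyq] at hcg hlg hlc
  have h1 : b c / g ≤ b f / g := hg (not_lt.1 hfc)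
  have h2 : b l / g ≤ b a / g := hg (not_lt.1 hal)
  have h3 : sep r q (b l / g) ≤ sep r q (b a / g) := sep_mono r hlg.le le_rfl h2
  have h4 : sep r (b f / g) q ≤ sep r (b c / g) q := sep_mono r hfg.le h1 le_rfl
  rw [sep_comm r q (b c / g), sep_comm r (b l / g) q] at hlc
  lia

theorem card_image_pair_badPart_le {sym grp r : ℕ → ℕ} {P : Finset ℕ} :
    ((badPart sym grp r P).image fun p => (grp p, sym p)).card ≤
      (jumps sym (fun x y => sep r (grp x) (grp y)) 0 (contraction sym grp P)).card +
      (revJumps sym (fun x y => sep r (grp x) (grp y)) 1 (revContraction sym grp P)).card := by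
  refine le_trans ?_ (add_le_add
    (Finset.card_image_le (f := fun p => (grp p, sym p)))
    (Finset.card_image_le (f := fun p => (grp p, sym p))))
  refine (Finset.card_le_card fun z hz => ?_).trans (Finset.card_union_le _ _)
  obtain ⟨p, hp, rfl⟩ := Finset.mem_image.1 hz
  rw [Finset.mem_union, Finset.mem_image, Finset.mem_image]
  rcases (Finset.mem_filter.1 hp).2 with ⟨x, hx, h1, h2⟩ | ⟨x, hx, h1, h2⟩
  · exact Or.inl ⟨x, hx, by rw [h1, h2]⟩
  · exact Or.inr ⟨x, hx, by rw [h1, h2]⟩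

/-- The recurrence for order five. -/
theorem LenBound.step_five {r : ℕ → ℕ} {c₀ d₀ c₁ d₁ c₂ d₂ c₃ d₃ c₄ d₄ d g M' : ℕ}
    (h₀ : LenBound 5 c₀ d₀ g) (h₁ : LenBound 4 c₁ d₁ g) (h₂ : LenBound 3 c₂ d₂ g)
    (h₃ : LenBound 5 c₃ d₃ M') (h₄ : JumpBound r 5 c₄ d₄ M') (hg : 1 ≤ g)
    (hgd : 2 * (2 * d₃ + 2 * (c₂ * d₄)) ≤ g) (hc : 2 * c₁ + 2 * c₃ + 2 * (c₂ * c₄) ≤ c₀)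
    (hd : d₀ + 2 * d₁ + d₂ + 2 ≤ d) : LenBound 5 c₀ d (g * M') := by
  intro sym b P m hP hb hB hm hmM
  by_cases hmg : m ≤ g
  · exact (h₀ sym b P m hP hb hB hm hmg).trans
      (Nat.add_le_add_left (Nat.mul_le_mul_right _ (by lia)) _)
  obtain ⟨hk, hX⟩ := ceil_groups hg (not_le.1 hmg) hmM hgd
  have hstep := card_le_add_mid (s := 4) h₀ h₁ hg hP hb hB hm
  have hmP : midPart sym (fun p => b p / g) P ⊆ P := Finset.filter_subset _ _
  -- The number of pairs here is as large as the contraction, but order two charges only the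
  -- constant 2 for each. The bad part keeps the order-three coefficient, on pairs counted by jumps
  -- only.
  have hgood := (lenBound_two g).card_groups_le hg hb (hB.mono (goodPart_subset.trans hmP))
    (fun p hp => hm p (hmP (goodPart_subset hp))) (Q := goodPart sym (fun p => b p / g) r P)
    (hasOrder_good hP hb)
  have hbad := h₂.card_groups_le hg hb (hB.mono (badPart_subset.trans hmP))
    (fun p hp => hm p (hmP (badPart_subset hp))) (Q := badPart sym (fun p => b p / g) r P)
    fun q => (hasOrder_mid hP hb q).mono (Finset.filter_subset_filter _ badPart_subset)
  have hcard : (midPart sym (fun p => b p / g) P).card =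
      (goodPart sym (fun p => b p / g) r P).card + (badPart sym (fun p => b p / g) r P).card :=
    (Finset.card_sdiff_add_card_eq_card badPart_subset).symm
  have hcon := h₃ sym _ _ _ (hP.mono contraction_subset) (monotone_div hb g) contraction_blocks
    (fun p hp => div_lt_ceil hm p (contraction_subset hp)) hk
  have hj1 := (h₄ sym _ _ _ (hP.mono contraction_subset) (monotone_div hb g) contraction_blocks
    (fun p hp => div_lt_ceil hm p (contraction_subset hp)) hk).1
  have hj2 := (h₄ sym _ _ _ (hP.mono revContraction_subset) (monotone_div hb g)
    revContraction_blocks (fun p hp => div_lt_ceil hm p (revContraction_subset hp)) hk).2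
  have hgp : ((goodPart sym (fun p => b p / g) r P).image fun p => (b p / g, sym p)).card ≤
      (contraction sym (fun p => b p / g) P).card :=
    (Finset.card_le_card (Finset.image_subset_image goodPart_subset)).trans
      card_image_pair_midPart_le
  have hbp := card_image_pair_badPart_le (sym := sym) (grp := fun p => b p / g) (r := r) (P := P)
  have hN := Nat.mul_le_mul_left c₄
    (numSym_revContraction_le (sym := sym) (grp := fun p => b p / g) (P := P))
  have h1 := Nat.mul_le_mul_left c₂ (hbp.trans (add_le_add hj1 (hj2.trans
    (Nat.add_le_add_right hN _))))
  have h2 := Nat.mul_le_mul_right m hd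
  have h3 := Nat.mul_le_mul_right (numSym sym (contraction sym (fun p => b p / g) P)) hc
  generalize numSym sym (contraction sym (fun p => b p / g) P) = N at *
  generalize (m - 1) / g + 1 = k at *
  linarith

end

/-! ### Solving the recurrences -/

/-- The coefficient of the number of symbols for order three. -/
def coefThree (i : ℕ) : ℕ := 4 * i + 64

/-- The coefficient of the number of symbols for order four. -/
def coefFour : ℕ → ℕ
  | 0 => 64
  | i + 1 => 2 * coefFour i + 2 * coefThree (i + 1)

/-- The coefficient of the number of symbols for jumps in order four. -/
def jumpFour : ℕ → ℕ
  | 0 => 64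
  | i + 1 => jumpFour i + coefThree (i + 1)

/-- The coefficient of the number of symbols for jumps in order five. -/
def jumpFive : ℕ → ℕ
  | 0 => 64
  | i + 1 => jumpFive i + jumpFour (i + 1)

/-- The coefficient of the number of symbols for order five. -/
def coefFive : ℕ → ℕ
  | 0 => 64
  | i + 1 => 2 * coefFive i + 2 * coefFour (i + 1) + 2 * (coefThree (i + 1) * jumpFive i)

theorem coefThree_le_coefFour (i : ℕ) : coefThree i ≤ coefFour i := by
  cases i <;> simp only [coefFour, coefThree] <;> lia

theorem coefThree_le_jumpFour (i : ℕ) : coefThree i ≤ jumpFour i := by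
  cases i <;> simp only [jumpFour, coefThree] <;> lia

theorem coefThree_le_jumpFive (i : ℕ) : coefThree i ≤ jumpFive i := by
  cases i with
  | zero => simp [jumpFive, coefThree]
  | succ i => exact (coefThree_le_jumpFour _).trans (Nat.le_add_left _ _)

theorem coefThree_le_coefFive (i : ℕ) : coefThree i ≤ coefFive i := by
  cases i with
  | zero => simp [coefFive, coefThree]
  | succ i =>
    have := coefThree_le_coefFour (i + 1)
    rw [coefFive]
    lia

/-- All the bounds on level `i` with parameter `j`, for up to `M` blocks. -/
structure LevelBounds (i j M : ℕ) : Prop where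
  three : LenBound 3 (coefThree i) (4 * j) M
  four : LenBound 4 (coefFour i) (4 * j ^ 2) M
  five : LenBound 5 (coefFive i) (4 * j ^ 3) M
  jump : ∃ r : ℕ → ℕ, (∀ t, 1 ≤ r t) ∧ JumpBound r 4 (jumpFour i) (2 * j ^ 2) M ∧
    JumpBound r 5 (jumpFive i) (j ^ 3) M

theorem LevelBounds.mono {i j M M' : ℕ} (h : LevelBounds i j M) (hM : M' ≤ M) :
    LevelBounds i j M' := by
  obtain ⟨r, hr, h4, h5⟩ := h.jump
  exact ⟨h.three.mono hM, h.four.mono hM, h.five.mono hM, r, hr, h4.mono hM, h5.mono hM⟩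

theorem levelBounds_base (i j : ℕ) : LevelBounds i j (coefThree i) :=
  ⟨.of_le _ _ le_rfl, .of_le _ _ (coefThree_le_coefFour i), .of_le _ _ (coefThree_le_coefFive i),
    fun _ => 1, fun _ => le_rfl, (LenBound.of_le _ _ (coefThree_le_jumpFour i)).jumpBound _,
    (LenBound.of_le _ _ (coefThree_le_jumpFive i)).jumpBound _⟩

/-- Groups are handled at `(i + 1, j)` and the contraction at `(i, w)`. The coefficients of `m` grow
by the lower orders' coefficients, hence the powers of `j`; hypothesis `hw` makes the groups long
enough to absorb the contraction's coefficient, of order `w ^ 3`. -/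
theorem LevelBounds.step {i j w g M : ℕ} (h : LevelBounds (i + 1) j g) (h' : LevelBounds i w M)
    (hg : 1 ≤ g) (hw : (16 + 4 * coefThree (i + 1)) * w ^ 3 ≤ g) :
    LevelBounds (i + 1) (j + 1) (g * M) := by
  obtain ⟨r, hr, h4, h5⟩ := h.jump
  obtain ⟨t, ht, h4', h5'⟩ := h'.jump
  have hw1 : w ^ 2 ≤ w ^ 3 := by
    rcases Nat.eq_zero_or_pos w with rfl | hw0
    · simp
    · exact Nat.pow_le_pow_right hw0 (by norm_num)
  have hw2 : w ≤ w ^ 3 := Nat.le_self_pow (by norm_num) w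
  have hw3 : (16 + 4 * 64) * w ^ 3 ≤ g :=
    (Nat.mul_le_mul_right _ (by rw [coefThree]; lia)).trans hw
  refine ⟨?_, ?_, ?_, glue g r t, fun x => ?_, ?_, ?_⟩
  · refine LenBound.step (s := 1) h.three (lenBound_two g) (lenBound_one g) h'.three hg ?_ ?_ ?_
    · lia
    · simp only [coefThree]; lia
    · lia
  · refine LenBound.step (s := 2) h.four h.three (lenBound_two g) h'.four hg ?_ ?_ ?_
    · lia
    · simp only [coefFour]; lia
    · nlinarith
  · refine LenBound.step_five h.five h.four h.three h'.five h5' hg ?_ ?_ ?_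
    · linarith
    · simp only [coefFive]; lia
    · nlinarith
  · rw [glue]
    split_ifs
    · exact (ht _).trans (Nat.le_add_left _ _)
    · exact hr _
  · refine JumpBound.step (s := 3) h4 (h.three.jumpBound r) h4' ht hg ?_ ?_ ?_
    · lia
    · simp only [jumpFour]; lia
    · nlinarith
  -- First parts of order-five groups have order four and inherit the rank `r`, so one rank has to
  -- serve both orders.
  · refine JumpBound.step (s := 4) h5 h4 h5' ht hg ?_ ?_ ?_
    · lia
    · simp only [jumpFive]; lia
    · rw [show (j + 1) ^ 3 = j ^ 3 + 3 * j ^ 2 + 3 * j + 1 by ring]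
      lia

/-! ### The Ackermann function -/

theorem acker_one (j : ℕ) : acker 1 (j + 1) = 2 ^ (j + 1) := by rw [acker]

theorem acker_one_right (i : ℕ) : acker (i + 1) 1 = 2 := by
  cases i <;> simp [acker]

theorem acker_succ (i j : ℕ) : acker (i + 2) (j + 2) =
    acker (i + 2) (j + 1) * acker (i + 1) (acker (i + 2) (j + 1)) := by rw [acker]

theorem two_le_acker (i j : ℕ) : 2 ≤ acker (i + 1) (j + 1) := by
  induction i generalizing j with
  | zero => rw [acker_one, pow_succ]; have := Nat.one_le_two_pow (n := j); lia
  | succ i ih =>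
    induction j with
    | zero => rw [acker_one_right]
    | succ j ihj =>
      rw [acker_succ]
      obtain ⟨w, hw⟩ := Nat.exists_eq_add_of_le' (show 1 ≤ acker (i + 2) (j + 1) by lia)
      have := ih w
      rw [hw] at ihj ⊢
      nlinarith

theorem two_mul_acker_le (i j : ℕ) : 2 * acker (i + 1) (j + 1) ≤ acker (i + 1) (j + 2) := by
  cases i with
  | zero => rw [acker_one, acker_one, pow_succ _ (j + 1)]; lia
  | succ i =>
    rw [acker_succ, mul_comm]
    obtain ⟨w, hw⟩ := Nat.exists_eq_add_of_le' (show 1 ≤ acker (i + 2) (j + 1) from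
      le_trans one_le_two (two_le_acker (i + 1) j))
    rw [hw]
    exact Nat.mul_le_mul_left _ (two_le_acker i w)

theorem two_pow_mul_acker_le (i j k : ℕ) :
    2 ^ k * acker (i + 1) (j + 1) ≤ acker (i + 1) (j + k + 1) := by
  induction k with
  | zero => simp
  | succ k ih =>
    have := two_mul_acker_le i (j + k)
    rw [pow_succ, show j + (k + 1) + 1 = j + k + 2 by ring]
    lia

theorem two_pow_le_acker (i k : ℕ) : 2 ^ (k + 1) ≤ acker (i + 1) (k + 1) := by
  have := two_pow_mul_acker_le i 0 k
  rw [zero_add, acker_one_right, zero_add, ← pow_succ] at this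
  exact this

theorem acker_mono_right (i : ℕ) {j k : ℕ} (h : j ≤ k) :
    acker (i + 1) (j + 1) ≤ acker (i + 1) (k + 1) := by
  obtain ⟨l, rfl⟩ := Nat.exists_eq_add_of_le h
  refine le_trans ?_ (two_pow_mul_acker_le i j l)
  exact Nat.le_mul_of_pos_left _ (by positivity)

theorem acker_two_right (i : ℕ) : acker (i + 1) 2 = 2 ^ (i + 2) := by
  induction i with
  | zero => rw [acker_one 1]
  | succ i ih => rw [acker_succ i 0, zero_add, acker_one_right, ih, pow_succ _ (i + 2), mul_comm]

/-- One more level pays for an exponentially larger second argument. -/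
theorem acker_le_succ (i j k : ℕ) (h : j + 1 ≤ 2 ^ (k + 1)) :
    2 ^ (k + 1) * acker (i + 1) (j + 1) ≤ acker (i + 2) (k + 2) := by
  rw [acker_succ]
  have h1 := two_pow_le_acker (i + 1) k
  obtain ⟨w, hw⟩ := Nat.exists_eq_add_of_le' (show 1 ≤ acker (i + 2) (k + 1) from
    le_trans one_le_two (two_le_acker (i + 1) k))
  rw [hw]
  -- Both factors use a_{i+2,k+1} ≥ 2^(k+1), which is at least `j + 1` by hypothesis.
  exact Nat.mul_le_mul (by rw [← hw]; exact h1) (acker_mono_right i (by lia))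

/-- The product of group size and number of groups follows a_{i,j} = w * a_{i-1,w}. The cube is
forced by the requirement that groups exceed a multiple of `w ^ 3` with w = a_{i,j-1}, and the
factor `8 * coefThree` covers that multiple. -/
theorem levelBounds_acker (i j : ℕ) :
    LevelBounds (i + 1) (j + 1) (8 * coefThree (i + 1) * acker (i + 1) (j + 1) ^ 3) := by
  induction i generalizing j with
  | zero =>
    induction j with
    | zero =>
      -- With `w = 0` the trivial bound has no term in `m`, so the condition on the group size is
      -- empty. At level one each such step multiplies the range by 64, while the cube of `2 ^ j`
      -- needs only 8.
      refine (LevelBounds.step (w := 0) (levelBounds_base 1 0) (levelBounds_base 0 0) ?_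
        (by simp)).mono ?_
      · simp [coefThree]
      · simp [coefThree, acker_one]
    | succ j ih =>
      refine (LevelBounds.step (w := 0) ih (levelBounds_base 0 0) ?_ (by simp)).mono ?_
      · have := two_le_acker 0 j
        have : 0 < acker (0 + 1) (j + 1) ^ 3 := pow_pos (by lia) 3
        simp only [coefThree]; lia
      · simp only [zero_add, acker_one, coefThree, pow_succ _ (j + 1), mul_pow]
        lia
  | succ i ihi =>
    induction j with
    | zero =>
      refine (LevelBounds.step (w := 0) (levelBounds_base (i + 2) 0) (levelBounds_base (i + 1) 0) ?_
        (by simp)).mono ?_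
      · simp [coefThree]
      · rw [acker_one_right]
        have : 64 ≤ coefThree (i + 1) := by rw [coefThree]; lia
        nlinarith
    | succ j ihj =>
      have hw := two_le_acker (i + 1) j
      obtain ⟨w, hw'⟩ := Nat.exists_eq_add_of_le' (show 1 ≤ acker (i + 2) (j + 1) by lia)
      have h1 : 64 ≤ coefThree (i + 1) := by rw [coefThree]; lia
      have h2 : 64 ≤ coefThree (i + 2) := by rw [coefThree]; lia
      refine (LevelBounds.step (w := w + 1) ihj (ihi w) ?_ ?_).mono ?_
      · have : 0 < acker (i + 1 + 1) (j + 1) ^ 3 := pow_pos (by lia) 3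
        nlinarith
      · rw [hw']
        exact Nat.mul_le_mul_right _ (by lia)
      · rw [acker_succ, hw', mul_pow, mul_assoc (8 * coefThree (i + 1 + 1))]
        refine Nat.mul_le_mul_left _ (Nat.mul_le_mul_left _ (Nat.le_mul_of_pos_left _ (by lia)))

/-! ### Growth of the coefficients -/

/-- The linear summand strengthens the induction so that doubling absorbs the linear inhomogeneity
of the recurrence. -/
theorem coefFour_le (i : ℕ) : coefFour i + (8 * i + 152) ≤ 216 * 2 ^ i := by
  induction i with
  | zero => simp [coefFour]
  | succ i ih =>
    rw [coefFour, coefThree, pow_succ]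
    lia

theorem jumpFour_le (i : ℕ) : jumpFour i ≤ 68 * (i + 1) ^ 2 := by
  induction i with
  | zero => simp [jumpFour]
  | succ i ih =>
    rw [jumpFour, coefThree]
    nlinarith

theorem jumpFive_le (i : ℕ) : jumpFive i ≤ 68 * (i + 1) ^ 3 := by
  induction i with
  | zero => simp [jumpFive]
  | succ i ih =>
    have := jumpFour_le (i + 1)
    rw [jumpFive, show (i + 1 + 1) ^ 3 = (i + 1) ^ 3 + (i + 1 + 1) ^ 2 +
      (2 * (i + 1) ^ 2 + (i + 1)) by ring]
    lia

theorem succ_pow_four_le (i : ℕ) : (i + 1) ^ 4 ≤ 64 * 2 ^ i := by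
  induction i using Nat.strong_induction_on with
  | _ i ih =>
    -- From 6 on, `(i + 1) ^ 4 ≤ 2 * i ^ 4`; smaller values are checked.
    rcases Nat.lt_or_ge i 6 with h | h
    · interval_cases i <;> norm_num
    · obtain ⟨k, rfl⟩ := Nat.exists_eq_add_of_le' h
      have h1 := ih (k + 5) (by lia)
      rw [show k + 6 = (k + 5) + 1 by ring, pow_succ 2 (k + 5)]
      nlinarith [pow_nonneg (Nat.zero_le k) 2, pow_nonneg (Nat.zero_le k) 3,
        pow_nonneg (Nat.zero_le k) 4]

theorem coefFive_le : ∃ C : ℕ, ∀ i, coefFive i ≤ C * ((i + 1) * 2 ^ i) := by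
  -- The step adds at most `(864 + 2 * 4624 * 64) * 2 ^ i`, whereas raising the linear factor gains
  -- `2 * 600000 * 2 ^ i`.
  refine ⟨600000, fun i => ?_⟩
  induction i with
  | zero => simp [coefFive]
  | succ i ih =>
    have h1 := coefFour_le (i + 1)
    have h2 : coefThree (i + 1) * jumpFive i ≤ (68 * (i + 1)) * (68 * (i + 1) ^ 3) :=
      Nat.mul_le_mul (by rw [coefThree]; lia) (jumpFive_le i)
    have h3 := succ_pow_four_le i
    rw [coefFive, pow_succ]
    rw [pow_succ] at h1
    have h4 : (68 * (i + 1)) * (68 * (i + 1) ^ 3) = 4624 * (i + 1) ^ 4 := by ring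
    nlinarith [Nat.one_le_two_pow (n := i)]

noncomputable section

open scoped Classical

/-! ### From sparse to blocked sequences -/

/-- The interval number of `p` after cutting before and behind every element of `F`. -/
def cut (F : Finset ℕ) (p : ℕ) : ℕ := (F.filter (· < p)).card + (F.filter (· ≤ p)).card

theorem cut_monotone (F : Finset ℕ) : Monotone (cut F) := fun _ _ h =>
  add_le_add
    (Finset.card_le_card (Finset.monotone_filter_right F fun _ _ hx => lt_of_lt_of_le hx h))
    (Finset.card_le_card (Finset.monotone_filter_right F fun _ _ hx => le_trans hx h))

theorem cut_lt (F : Finset ℕ) (p : ℕ) : cut F p < 2 * F.card + 1 := by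
  have h1 := Finset.card_filter_le F (· < p)
  have h2 := Finset.card_filter_le F (· ≤ p)
  rw [cut]
  lia

/-- Both counts in `cut` are monotone, and an element of `F` in `[p, q]` makes one of them strictly
larger: the strict count if it is below `q`, the other if it equals `q`. -/
theorem not_mem_of_cut_eq {F : Finset ℕ} {p q x : ℕ} (hpq : p < q) (h : cut F p = cut F q)
    (hpx : p ≤ x) (hxq : x ≤ q) : x ∉ F := by
  intro hx
  have h1 : F.filter (· < p) ⊆ F.filter (· < q) :=
    Finset.monotone_filter_right F fun _ _ hy => lt_trans hy hpq
  have h2 : F.filter (· ≤ p) ⊆ F.filter (· ≤ q) :=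
    Finset.monotone_filter_right F fun _ _ hy => le_trans hy hpq.le
  have h1' := Finset.card_le_card h1
  have h2' := Finset.card_le_card h2
  rw [cut, cut] at h
  rcases lt_or_eq_of_le hxq with hlt | rfl
  · have : (F.filter (· < p)).card < (F.filter (· < q)).card := by
      refine Finset.card_lt_card ((Finset.ssubset_iff_of_subset h1).2 ⟨x, ?_, ?_⟩)
      · exact Finset.mem_filter.2 ⟨hx, hlt⟩
      · exact fun h' => absurd (Finset.mem_filter.1 h').2 (not_lt.2 hpx)
    lia
  · have : (F.filter (· ≤ p)).card < (F.filter (· ≤ x)).card := by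
      refine Finset.card_lt_card ((Finset.ssubset_iff_of_subset h2).2 ⟨x, ?_, ?_⟩)
      · exact Finset.mem_filter.2 ⟨hx, le_rfl⟩
      · exact fun h' => absurd (Finset.mem_filter.1 h').2 (not_le.2 hpq)
    lia

/-- The first occurrences of the symbols in the groups. -/
def firsts (sym grp : ℕ → ℕ) (P : Finset ℕ) : Finset ℕ :=
  P.filter fun p => ∀ x ∈ P, sym x = sym p → grp x = grp p → p ≤ x

/-- The last occurrences of the symbols in the groups. -/
def lasts (sym grp : ℕ → ℕ) (P : Finset ℕ) : Finset ℕ :=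
  P.filter fun p => ∀ x ∈ P, sym x = sym p → grp x = grp p → x ≤ p

/-- The first and last occurrences of the symbols in the groups. -/
def ends (sym grp : ℕ → ℕ) (P : Finset ℕ) : Finset ℕ := firsts sym grp P ∪ lasts sym grp P

section Cut

variable {sym grp : ℕ → ℕ} {P : Finset ℕ} {s : ℕ}

theorem exists_mem_firsts {p : ℕ} (hp : p ∈ P) :
    ∃ x ∈ firsts sym grp P, sym x = sym p ∧ grp x = grp p ∧ x ≤ p := by
  obtain ⟨x, hx, hmin⟩ := Finset.exists_min_image
    (P.filter fun x => sym x = sym p ∧ grp x = grp p) id ⟨p, Finset.mem_filter.2 ⟨hp, rfl, rfl⟩⟩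
  obtain ⟨hxP, h1, h2⟩ := Finset.mem_filter.1 hx
  exact ⟨x, Finset.mem_filter.2 ⟨hxP, fun y hy h h' => hmin y (Finset.mem_filter.2
    ⟨hy, h.trans h1, h'.trans h2⟩)⟩, h1, h2, hmin p (Finset.mem_filter.2 ⟨hp, rfl, rfl⟩)⟩

theorem exists_mem_lasts {p : ℕ} (hp : p ∈ P) :
    ∃ x ∈ lasts sym grp P, sym x = sym p ∧ grp x = grp p ∧ p ≤ x := by
  obtain ⟨x, hx, hmax⟩ := Finset.exists_max_image
    (P.filter fun x => sym x = sym p ∧ grp x = grp p) id ⟨p, Finset.mem_filter.2 ⟨hp, rfl, rfl⟩⟩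
  obtain ⟨hxP, h1, h2⟩ := Finset.mem_filter.1 hx
  exact ⟨x, Finset.mem_filter.2 ⟨hxP, fun y hy h h' => hmax y (Finset.mem_filter.2
    ⟨hy, h.trans h1, h'.trans h2⟩)⟩, h1, h2, hmax p (Finset.mem_filter.2 ⟨hp, rfl, rfl⟩)⟩

theorem firsts_blocked : IsBlocked sym grp (firsts sym grp P) := fun p hp q hq h1 h2 => by
  obtain ⟨hp1, hp2⟩ := Finset.mem_filter.1 hp
  obtain ⟨hq1, hq2⟩ := Finset.mem_filter.1 hq
  exact le_antisymm (hp2 q hq1 h1.symm h2.symm) (hq2 p hp1 h1 h2)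

theorem lasts_blocked : IsBlocked sym grp (lasts sym grp P) := fun p hp q hq h1 h2 => by
  obtain ⟨hp1, hp2⟩ := Finset.mem_filter.1 hp
  obtain ⟨hq1, hq2⟩ := Finset.mem_filter.1 hq
  exact le_antisymm (hq2 p hp1 h1 h2) (hp2 q hq1 h1.symm h2.symm)

theorem card_lasts_le : (lasts sym grp P).card ≤ (firsts sym grp P).card := by
  refine le_trans ?_ (Finset.card_image_le (f := fun p => (sym p, grp p)))
  refine Finset.card_le_card_of_injOn (fun p => (sym p, grp p)) (fun p hp => ?_)
    fun p hp q hq hpq => ?_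
  · obtain ⟨x, hx, h1, h2, -⟩ := exists_mem_firsts (sym := sym) (grp := grp)
      (Finset.mem_filter.1 hp).1
    exact Finset.mem_coe.2 (Finset.mem_image.2 ⟨x, hx, by rw [h1, h2]⟩)
  · simp only [Prod.mk.injEq] at hpq
    exact lasts_blocked p hp q hq hpq.1 hpq.2

theorem card_ends_le : (ends sym grp P).card ≤ 2 * (firsts sym grp P).card := by
  have := card_lasts_le (sym := sym) (grp := grp) (P := P)
  have := Finset.card_union_le (firsts sym grp P) (lasts sym grp P)
  rw [ends]
  lia

/-- Cutting around the first and last occurrences in the groups lowers the order by two. -/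
theorem hasOrder_cut (hg : Monotone grp)
    (h : ∀ u, HasOrder sym (s + 2) (P.filter fun p => grp p = u)) (q : ℕ) :
    HasOrder sym s (P.filter fun p => cut (ends sym grp P) p = q) := by
  intro a b hab hal
  obtain ⟨y, hy, hya⟩ := hal.exists_left
  obtain ⟨z, hz, hzb⟩ := hal.exists_right
  have hyz : y ≠ z := by
    rintro rfl
    exact hab (hya.symm.trans hzb)
  set Q := P.filter fun p => cut (ends sym grp P) p = q with hQdef
  have hQP : Q ⊆ P := Finset.filter_subset _ _
  have hcut : ∀ u ∈ Q, ∀ v ∈ Q, ∀ x ∈ ends sym grp P, u ≤ x → ¬ x < v := by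
    intro u hu v hv x hx hux hxv
    exact not_mem_of_cut_eq (hux.trans_lt hxv) ((Finset.mem_filter.1 hu).2.trans
      (Finset.mem_filter.1 hv).2.symm) hux hxv.le hx
  have hcut' : ∀ u ∈ Q, ∀ v ∈ Q, ∀ x ∈ ends sym grp P, u < x → ¬ x ≤ v := by
    intro u hu v hv x hx hux hxv
    exact not_mem_of_cut_eq (hux.trans_le hxv) ((Finset.mem_filter.1 hu).2.trans
      (Finset.mem_filter.1 hv).2.symm) hux.le hxv hx
  -- An end has an interval to itself, but `Q` has two different elements.
  have hnot : ∀ x ∈ Q, x ∉ ends sym grp P := by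
    intro x hx hxe
    have hlt : ∀ v ∈ Q, v = x := by
      intro v hv
      rcases lt_trichotomy v x with h1 | h1 | h1
      · exact absurd le_rfl (hcut' v hv x hx x hxe h1)
      · exact h1
      · exact absurd h1 (hcut x hx v hv x hxe le_rfl)
    exact hyz ((hlt y hy).trans (hlt z hz).symm)
  have hbefore : ∀ x ∈ Q, ∃ f ∈ P, sym f = sym x ∧ grp f = grp x ∧ ∀ v ∈ Q, f < v := by
    intro x hx
    obtain ⟨f, hf, h1, h2, hfx⟩ := exists_mem_firsts (sym := sym) (grp := grp) (hQP hx)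
    have hfe : f ∈ ends sym grp P := Finset.mem_union_left _ hf
    have hlt : f < x := lt_of_le_of_ne hfx fun h' => hnot x hx (h' ▸ hfe)
    exact ⟨f, (Finset.mem_filter.1 hf).1, h1, h2,
      fun v hv => lt_of_not_ge fun hvf => hcut v hv x hx f hfe hvf hlt⟩
  have hafter : ∀ x ∈ Q, ∃ f ∈ P, sym f = sym x ∧ grp f = grp x ∧ ∀ v ∈ Q, v < f := by
    intro x hx
    obtain ⟨f, hf, h1, h2, hfx⟩ := exists_mem_lasts (sym := sym) (grp := grp) (hQP hx)
    have hfe : f ∈ ends sym grp P := Finset.mem_union_right _ hf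
    have hlt : x < f := lt_of_le_of_ne hfx fun h' => hnot x hx (h' ▸ hfe)
    exact ⟨f, (Finset.mem_filter.1 hf).1, h1, h2,
      fun v hv => lt_of_not_ge fun hvf => hcut' x hx v hv f hfe hlt hvf⟩
  -- The first and last occurrence of a symbol of `Q` in one group enclose all of `Q`, so `Q` does
  -- not leave that group.
  have hgrp : ∀ x ∈ Q, grp x = grp y := by
    intro x hx
    obtain ⟨f, -, -, h2, hf⟩ := hbefore x hx
    obtain ⟨f', -, -, h2', hf'⟩ := hafter x hx
    exact le_antisymm (h2 ▸ hg (hf y hy).le) (h2' ▸ hg (hf' y hy).le)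
  refine (h (grp y)).of_before_after (Q := Q)
    (fun x hx => Finset.mem_filter.2 ⟨hQP hx, hgrp x hx⟩) (fun x hx => ?_) (fun x hx => ?_)
    a b hab hal
  · obtain ⟨f, hf, h1, h2, h3⟩ := hbefore x hx
    exact ⟨f, Finset.mem_filter.2 ⟨hf, h2.trans (hgrp x hx)⟩, h1, h3⟩
  · obtain ⟨f, hf, h1, h2, h3⟩ := hafter x hx
    exact ⟨f, Finset.mem_filter.2 ⟨hf, h2.trans (hgrp x hx)⟩, h1, h3⟩

/-- Between two occurrences of a symbol there is another symbol. -/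
def IsSparse (sym : ℕ → ℕ) (P : Finset ℕ) : Prop :=
  ∀ p ∈ P, ∀ q ∈ P, p < q → sym p = sym q → ∃ r ∈ P, p < r ∧ r < q ∧ sym r ≠ sym p

/-- Cutting around the global ends gives at most `4 * n + 1` intervals of order three. Their first
occurrences form a blocked sequence, so the bound at `(i, j)` limits the ends for a second cut, to
order one. Pieces of order one in a sparse sequence have distinct symbols, and the bound at `(i',
j')` applies to all of `P`. -/
theorem card_le_of_sparse {i j i' j' M M' : ℕ} (h : LevelBounds i j M)
    (h' : LevelBounds i' j' M') (hP : HasOrder sym 5 P) (hS : IsSparse sym P)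
    (hM : 4 * numSym sym P + 1 ≤ M)
    (hM' : 4 * (coefFive i * numSym sym P + 4 * j ^ 3 * (4 * numSym sym P + 1)) + 1 ≤ M') :
    P.card ≤ coefFive i' * numSym sym P + 4 * j' ^ 3 *
      (4 * (coefFive i * numSym sym P + 4 * j ^ 3 * (4 * numSym sym P + 1)) + 1) := by
  set n := numSym sym P
  let F₀ := ends sym (fun _ => 0) P
  have hF₀ : F₀.card ≤ 2 * n := by
    refine card_ends_le.trans (Nat.mul_le_mul_left _ ?_)
    have := firsts_blocked (sym := sym) (grp := fun _ => 0) (P := P)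
    refine (this.card_le_mul (m := 1) (by simp)).trans ?_
    rw [one_mul]
    exact numSym_mono (Finset.filter_subset _ _)
  let b₁ := cut F₀
  have hb₁ : ∀ u, HasOrder sym 3 (P.filter fun p => b₁ p = u) :=
    hasOrder_cut (s := 3) monotone_const fun u => hP.mono (Finset.filter_subset _ _)
  let F₁ := ends sym b₁ P
  let b₂ := cut F₁
  have hb₂ : ∀ u, HasOrder sym 1 (P.filter fun p => b₂ p = u) :=
    hasOrder_cut (s := 1) (cut_monotone _) hb₁
  have hf : (firsts sym b₁ P).card ≤ coefFive i * n + 4 * j ^ 3 * (4 * n + 1) := by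
    have hsub : firsts sym b₁ P ⊆ P := Finset.filter_subset _ _
    refine (h.five sym b₁ (firsts sym b₁ P) (4 * n + 1) (hP.mono hsub) (cut_monotone _)
      firsts_blocked (fun p _ => (cut_lt F₀ p).trans_le (by lia)) hM).trans ?_
    exact Nat.add_le_add_right (Nat.mul_le_mul_left _ (numSym_mono hsub)) _
  have hF₁ : F₁.card ≤ 2 * (firsts sym b₁ P).card := card_ends_le
  refine h'.five sym b₂ P _ hP (cut_monotone _) (fun p hp q hq h1 h2 => ?_)
    (fun p _ => (cut_lt F₁ p).trans_le ?_) hM'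
  · by_contra hne
    wlog hlt : p < q generalizing p q
    · exact this q hq p hp h1.symm h2.symm (Ne.symm hne)
        (lt_of_le_of_ne (not_lt.1 hlt) (Ne.symm hne))
    obtain ⟨r, hr, hpr, hrq, hrs⟩ := hS p hp q hq hlt h1
    have hbr : b₂ r = b₂ p :=
      le_antisymm (h2 ▸ cut_monotone F₁ hrq.le) (cut_monotone F₁ hpr.le)
    refine hb₂ (b₂ p) (sym p) (sym r) hrs.symm ⟨[p, r, q], ?_, ?_, ?_⟩
    · simp [hpr, hrq, hlt]
    · simp [hp, hr, hq, hbr, h2]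
    · simp [h1, altWord]
  · lia

end Cut

/-! ### Bounds in terms of the inverse Ackermann function -/

theorem invAck₂_spec (n m : ℕ) :
    1 ≤ invAck₂ n m ∧ m ≤ acker (invAck₂ n m) (max ⌈(n : ℚ) / (m : ℚ)⌉₊ 3) := by
  refine Nat.sInf_mem (s := {i | 1 ≤ i ∧ m ≤ acker i (max ⌈(n : ℚ) / (m : ℚ)⌉₊ 3)})
    -- Level `m + 1` suffices because a_{m+1,2} = 2^(m+2).
    ⟨m + 1, Nat.le_add_left _ _, ?_⟩
  obtain ⟨j, hj⟩ := Nat.exists_eq_add_of_le' (show 1 ≤ max ⌈(n : ℚ) / (m : ℚ)⌉₊ 3 by lia)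
  rw [hj]
  refine le_trans ?_ (acker_mono_right m (show 1 ≤ j by lia))
  rw [acker_two_right]
  exact (Nat.lt_two_pow_self (n := m)).le.trans (Nat.pow_le_pow_right (by lia) (by lia))

theorem ceil_div_le {n m : ℕ} (h : n ≤ m) : max ⌈(n : ℚ) / (m : ℚ)⌉₊ 3 = 3 := by
  refine max_eq_right (le_trans (Nat.ceil_le.2 ?_) (show 1 ≤ 3 by lia))
  rw [Nat.cast_one]
  exact div_le_one_of_le₀ (by exact_mod_cast h) (by positivity)

/-- For `n ≤ m` both definitions use the second argument 3, and the requirement for `n` is the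
weaker one. -/
theorem invAck_le_invAck₂ {n m : ℕ} (h : n ≤ m) : invAck n ≤ invAck₂ n m := by
  obtain ⟨h1, h2⟩ := invAck₂_spec n m
  rw [ceil_div_le h] at h2
  refine Nat.sInf_le ⟨h1, ?_⟩
  rw [ceil_div_le le_rfl]
  exact h.trans h2

theorem le_invAck_mul {i : ℕ} (hi : 1 ≤ i) : (i + 1) * 2 ^ i ≤ 2 * (i * 2 ^ i) := by
  rw [← mul_assoc]
  exact Nat.mul_le_mul_right _ (by lia)

theorem acker_le_cube (i j : ℕ) : acker (i + 1) (j + 1) ≤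
    8 * coefThree (i + 1) * acker (i + 1) (j + 1) ^ 3 := by
  refine (Nat.le_self_pow (by norm_num : (3 : ℕ) ≠ 0) _).trans (Nat.le_mul_of_pos_left _ ?_)
  rw [coefThree]
  lia

/-- Sparse sequences of order five. -/
theorem exists_sparse_bound : ∃ C : ℕ, ∀ (sym : ℕ → ℕ) (P : Finset ℕ), HasOrder sym 5 P →
    IsSparse sym P → 1 ≤ numSym sym P →
    P.card ≤ C * (numSym sym P * (invAck (numSym sym P) * 2 ^ invAck (numSym sym P))) := by
  obtain ⟨C, hC⟩ := coefFive_le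
  -- The number of final pieces is at most `K * n * A`: `4 * C` from the coefficient of `n`, and
  -- 2161 = 16 * 108 + 4 * 108 + 1 from the blocks, where 108 is `4 * 3 ^ 3`.
  obtain ⟨K, hK⟩ : ∃ K, K = 4 * C + 2161 := ⟨_, rfl⟩
  refine ⟨8 * C + 8 * (K + 2) ^ 3 * K, fun sym P hP hS hn => ?_⟩
  set n := numSym sym P
  obtain ⟨h1, h2⟩ := invAck₂_spec n n
  rw [ceil_div_le le_rfl] at h2
  rw [invAck]
  have hA := le_invAck_mul h1
  obtain ⟨i, hi⟩ := Nat.exists_eq_add_of_le' h1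
  rw [hi] at h2 hA ⊢
  set A := (i + 1 + 1) * 2 ^ (i + 1) with hAdef
  have hA1 : 1 ≤ A := Nat.mul_pos (by lia) (by positivity)
  have hT : 4 * (coefFive (i + 1) * n + 4 * (2 + 1) ^ 3 * (4 * n + 1)) + 1 ≤ K * (n * A) := by
    have h3 : coefFive (i + 1) * n ≤ C * A * n := Nat.mul_le_mul_right _ (hC (i + 1))
    have h4 : n ≤ n * A := Nat.le_mul_of_pos_right _ hA1
    have h5 : C * A * n = C * (n * A) := by ring
    rw [hK, add_mul, mul_assoc]
    lia
  have hX1 := acker_le_succ i 2 K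
    ((hK ▸ (by lia : 3 ≤ 4 * C + 2161 + 1)).trans Nat.lt_two_pow_self.le)
  have hX2 : 2 ^ (i + 3) ≤ acker (i + 2) (K + 2) := by
    rw [← acker_two_right (i + 1)]
    exact acker_mono_right (i + 1) (Nat.le_add_left 1 K)
  -- One level higher, with the constant second argument `K + 2`, the Ackermann value dominates `K *
  -- n`, and its square dominates `A`; the cube in `levelBounds_acker` covers the product.
  have hM' : K * (n * A) ≤ 8 * coefThree (i + 2) * acker (i + 2) (K + 2) ^ 3 := by
    have e1 : K * n ≤ acker (i + 2) (K + 2) :=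
      (Nat.mul_le_mul (Nat.lt_two_pow_self.le.trans
        (Nat.pow_le_pow_right two_pos (Nat.le_succ K))) h2).trans hX1
    have e2 : A ≤ 2 ^ (i + 3) * 2 ^ (i + 3) := by
      refine Nat.mul_le_mul ?_ (Nat.pow_le_pow_right two_pos (Nat.add_le_add_left (by simp) i))
      exact (Nat.lt_two_pow_self (n := i + 1 + 1)).le.trans
        (Nat.pow_le_pow_right two_pos (Nat.le_succ (i + 2)))
    calc K * (n * A) = K * n * A := by ring
      _ ≤ acker (i + 2) (K + 2) * (acker (i + 2) (K + 2) * acker (i + 2) (K + 2)) :=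
          Nat.mul_le_mul e1 (e2.trans (Nat.mul_le_mul hX2 hX2))
      _ = acker (i + 2) (K + 2) ^ 3 := by ring
      _ ≤ _ := Nat.le_mul_of_pos_left _ (by rw [coefThree]; lia)
  have hM : 4 * n + 1 ≤ 8 * coefThree (i + 1) * acker (i + 1) (2 + 1) ^ 3 := by
    have e1 := Nat.le_self_pow (by norm_num : (3 : ℕ) ≠ 0) (acker (i + 1) (2 + 1))
    have e2 : 64 ≤ coefThree (i + 1) := by rw [coefThree]; lia
    have e3 : n ≤ acker (i + 1) (2 + 1) ^ 3 := h2.trans e1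
    have e4 : 8 * 64 * n ≤ 8 * coefThree (i + 1) * acker (i + 1) (2 + 1) ^ 3 :=
      Nat.mul_le_mul (Nat.mul_le_mul_left _ e2) e3
    lia
  have key := card_le_of_sparse (levelBounds_acker i 2) (levelBounds_acker (i + 1) (K + 1)) hP hS
    hM (hT.trans hM')
  refine key.trans ?_
  have h3 : coefFive (i + 2) * n ≤ C * (4 * A) * n := by
    refine Nat.mul_le_mul_right _ ((hC (i + 2)).trans (Nat.mul_le_mul_left _ ?_))
    rw [hAdef, pow_succ _ (i + 1)]
    nlinarith [Nat.one_le_two_pow (n := i + 1)]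
  have h4 := Nat.mul_le_mul_left (4 * (K + 1 + 1) ^ 3) hT
  have h5 : n * A ≤ n * (2 * ((i + 1) * 2 ^ (i + 1))) := Nat.mul_le_mul_left _ hA
  calc _ ≤ C * (4 * A) * n + 4 * (K + 1 + 1) ^ 3 * (K * (n * A)) := add_le_add h3 h4
    _ = (4 * C + 4 * (K + 2) ^ 3 * K) * (n * A) := by ring
    _ ≤ (4 * C + 4 * (K + 2) ^ 3 * K) * (n * (2 * ((i + 1) * 2 ^ (i + 1)))) :=
        Nat.mul_le_mul_left _ h5
    _ = _ := by ring

/-- Blocked sequences of order five with at most as many blocks as symbols. -/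
theorem exists_blocked_bound : ∃ C : ℕ, ∀ (sym b : ℕ → ℕ) (P : Finset ℕ) (m : ℕ),
    HasOrder sym 5 P → Monotone b → IsBlocked sym b P → (∀ p ∈ P, b p < m) → 1 ≤ m →
    m ≤ numSym sym P →
    P.card ≤ C * (numSym sym P * (invAck₂ (numSym sym P) m * 2 ^ invAck₂ (numSym sym P) m)) := by
  obtain ⟨C, hC⟩ := coefFive_le
  refine ⟨8 * C + 2 * 2560, fun sym b P m hP hb hB hbm hm hmn => ?_⟩
  set n := numSym sym P
  obtain ⟨h1, h2⟩ := invAck₂_spec n m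
  have hA := le_invAck_mul h1
  have hJ : max ⌈(n : ℚ) / (m : ℚ)⌉₊ 3 * m ≤ 5 * n := by
    have hm' : (0 : ℚ) < m := by exact_mod_cast hm
    have h3 : ⌈(n : ℚ) / (m : ℚ)⌉₊ * m ≤ n + m := by
      have := (Nat.ceil_lt_add_one (show (0 : ℚ) ≤ (n : ℚ) / m by positivity)).le
      have h4 := mul_le_mul_of_nonneg_right this hm'.le
      rw [add_mul, div_mul_cancel₀ _ hm'.ne', one_mul] at h4
      exact_mod_cast h4
    rcases le_total ⌈(n : ℚ) / (m : ℚ)⌉₊ 3 with h | h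
    · rw [max_eq_right h]; lia
    · rw [max_eq_left h]; lia
  generalize hJ' : max ⌈(n : ℚ) / (m : ℚ)⌉₊ 3 = J at hJ h2
  have hJ3 : 3 ≤ J := hJ' ▸ le_max_right _ _
  obtain ⟨i, hi⟩ := Nat.exists_eq_add_of_le' h1
  rw [hi] at h2 hA ⊢
  obtain ⟨j, rfl⟩ := Nat.exists_eq_add_of_le' (show 1 ≤ J by lia)
  -- One level up, a second argument logarithmic in `J` suffices. The coefficient of `m` is then
  -- polylogarithmic in `J`, hence O(`J`), and `J * m` is O(`n`).
  set k := Nat.log 2 (j + 1)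
  have hk1 : j + 1 < 2 ^ (k + 1) := Nat.lt_pow_succ_log_self (by lia) _
  have hk2 : 2 ^ k ≤ j + 1 := Nat.pow_log_le_self 2 (by lia)
  have hmM : m ≤ 8 * coefThree (i + 2) * acker (i + 2) (k + 2) ^ 3 := by
    refine h2.trans (le_trans ?_ (acker_le_cube (i + 1) (k + 1)))
    exact (Nat.le_mul_of_pos_left _ (by positivity)).trans (acker_le_succ i j k hk1.le)
  have key := (levelBounds_acker (i + 1) (k + 1)).five sym b P m hP hb hB hbm hmM
  refine key.trans ?_
  have hk3 : (k + 1 + 1) ^ 3 ≤ 128 * (j + 1) := by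
    have e1 := succ_pow_four_le (k + 1)
    have e2 : (k + 1 + 1) ^ 3 ≤ (k + 1 + 1) ^ 4 := Nat.pow_le_pow_right (by lia) (by lia)
    rw [pow_succ 2 k] at e1
    lia
  set A := (i + 1 + 1) * 2 ^ (i + 1) with hAdef
  have hA1 : 1 ≤ A := Nat.mul_pos (by lia) (by positivity)
  have h3 : coefFive (i + 2) * n ≤ C * (4 * A) * n := by
    refine Nat.mul_le_mul_right _ ((hC (i + 2)).trans (Nat.mul_le_mul_left _ ?_))
    rw [hAdef, pow_succ _ (i + 1)]
    nlinarith [Nat.one_le_two_pow (n := i + 1)]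
  have h4 : 4 * (k + 1 + 1) ^ 3 * m ≤ 2560 * n := by
    calc 4 * (k + 1 + 1) ^ 3 * m ≤ 4 * (128 * (j + 1)) * m :=
          Nat.mul_le_mul_right _ (Nat.mul_le_mul_left _ hk3)
      _ = 512 * ((j + 1) * m) := by ring
      _ ≤ 2560 * n := by lia
  have h5 : n * A ≤ n * (2 * ((i + 1) * 2 ^ (i + 1))) := Nat.mul_le_mul_left _ hA
  have h6 : n ≤ n * A := Nat.le_mul_of_pos_right _ hA1
  calc _ ≤ C * (4 * A) * n + 2560 * (n * A) := add_le_add h3 (h4.trans (Nat.mul_le_mul_left _ h6))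
    _ = (4 * C + 2560) * (n * A) := by ring
    _ ≤ (4 * C + 2560) * (n * (2 * ((i + 1) * 2 ^ (i + 1)))) := Nat.mul_le_mul_left _ h5
    _ = _ := by ring

/-! ### Lists as sets of positions -/

theorem map_getD_range (S : List ℕ) :
    (List.range S.length).map (fun p => S.getD p 0) = S := by
  refine List.ext_getElem (by simp) fun i h1 h2 => ?_
  simp [List.getElem?_eq_getElem h2]

theorem hasOrder_of_not_occurs {S : List ℕ} (h : ¬ Occurs (alternating 7) S) :
    HasOrder (fun p => S.getD p 0) 5 (Finset.range S.length) := by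
  rintro a b hab ⟨l, h1, h2, h3⟩
  refine h ⟨l.map fun p => S.getD p 0, ?_, fun x => if x = 0 then a else b, ?_, ?_⟩
  · have hsub : l.Sublist (List.range S.length) := by
      refine List.sublist_of_subperm_of_pairwise (r := (· ≤ ·)) (List.Nodup.subperm ?_ ?_)
        (h1.imp le_of_lt) (List.pairwise_lt_range.imp le_of_lt)
      · exact h1.imp ne_of_lt
      · exact fun p hp => List.mem_range.2 (Finset.mem_range.1 (h2 p hp))
    have := hsub.map fun p => S.getD p 0
    rwa [map_getD_range] at this
  · have h7 : alternating 7 = [0, 1, 0, 1, 0, 1, 0] := by decide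
    intro x hx y hy hxy
    rw [h7] at hx hy
    simp only [List.mem_cons, List.not_mem_nil, or_false, Set.mem_ofPred_eq] at hx hy
    have hx' : x = 0 ∨ x = 1 := by tauto
    have hy' : y = 0 ∨ y = 1 := by tauto
    rcases hx' with rfl | rfl <;> rcases hy' with rfl | rfl <;> simp_all
  · have h7 : alternating 7 = [0, 1, 0, 1, 0, 1, 0] := by decide
    rw [h3, h7]
    simp [altWord]

theorem alphabetSize_eq_numSym (S : List ℕ) :
    alphabetSize S = numSym (fun p => S.getD p 0) (Finset.range S.length) := by
  rw [alphabetSize, numSym]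
  congr 1
  conv_lhs => rw [← map_getD_range S]
  ext a
  simp

theorem isSparse_of_sparse {S : List ℕ} (h : Sparse 2 S) :
    IsSparse (fun p => S.getD p 0) (Finset.range S.length) := by
  intro p hp q hq hpq hs
  rw [Finset.mem_range] at hp hq
  simp only [List.getD_eq_getElem _ _ hp, List.getD_eq_getElem _ _ hq] at hs
  have h2 := h p q hpq hq hs
  have hp1 : p + 1 < S.length := by lia
  refine ⟨p + 1, Finset.mem_range.2 hp1, by lia, by lia, fun h' => ?_⟩
  simp only [List.getD_eq_getElem _ _ hp, List.getD_eq_getElem _ _ hp1] at h'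
  have := h p (p + 1) (by lia) hp1 h'.symm
  lia

theorem exists_blocks (L : List (List ℕ)) (hL : ∀ B ∈ L, B.Nodup) :
    ∃ b : ℕ → ℕ, Monotone b ∧
      IsBlocked (fun p => L.flatten.getD p 0) b (Finset.range L.flatten.length) ∧
      ∀ p ∈ Finset.range L.flatten.length, b p < L.length := by
  induction L with
  | nil => exact ⟨fun _ => 0, monotone_const, by simp [IsBlocked], by simp⟩
  | cons B L ih =>
    obtain ⟨b, hb, hB, hm⟩ := ih fun B' h => hL B' (by simp [h])
    have hnd := hL B (by simp)
    refine ⟨fun p => if p < B.length then 0 else b (p - B.length) + 1, fun p q hpq => ?_,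
      fun p hp q hq hs hbq => ?_, fun p hp => ?_⟩
    · have := hb (Nat.sub_le_sub_right hpq B.length)
      simp only
      split_ifs <;> lia
    · simp only [List.flatten_cons, Finset.mem_range, List.length_append] at hp hq
      simp only [List.flatten_cons] at hs
      by_cases h1 : p < B.length <;> by_cases h2 : q < B.length
      · rw [List.getD_append _ _ _ _ h1, List.getD_append _ _ _ _ h2,
          List.getD_eq_getElem _ _ h1, List.getD_eq_getElem _ _ h2] at hs
        exact (hnd.getElem_inj_iff).1 hs
      · simp [h1, h2] at hbq
      · simp [h1, h2] at hbq
      · simp only [h1, h2, if_false, Nat.add_right_cancel_iff] at hbq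
        rw [List.getD_append_right _ _ _ _ (not_lt.1 h1),
          List.getD_append_right _ _ _ _ (not_lt.1 h2)] at hs
        have := hB (p - B.length) (Finset.mem_range.2 (by lia)) (q - B.length)
          (Finset.mem_range.2 (by lia)) hs hbq
        lia
    · simp only [List.flatten_cons, Finset.mem_range, List.length_append] at hp
      rw [List.length_cons]
      by_cases h1 : p < B.length
      · simp [h1]
      · simp only [h1, if_false]
        have := hm (p - B.length) (Finset.mem_range.2 (by lia))
        lia

/-- Deleting at most one position per block makes a blocked sequence sparse. -/
theorem exists_sparse_subset {sym b : ℕ → ℕ} {N m : ℕ} (hb : Monotone b)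
    (hB : IsBlocked sym b (Finset.range N)) (hm : ∀ p ∈ Finset.range N, b p < m) :
    ∃ P ⊆ Finset.range N, IsSparse sym P ∧
      numSym sym P = numSym sym (Finset.range N) ∧ N ≤ P.card + m := by
  -- One position of each run of equal symbols is kept. A deleted position repeats its predecessor
  -- and so begins a new block, which makes `b` injective on the deleted ones.
  refine ⟨(Finset.range N).filter fun p => p = 0 ∨ sym p ≠ sym (p - 1), Finset.filter_subset _ _,
    fun p hp q hq hpq hs => ?_, (numSym_mono (Finset.filter_subset _ _)).antisymm ?_, ?_⟩
  · obtain ⟨hp1, -⟩ := Finset.mem_filter.1 hp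
    obtain ⟨hq1, hq2⟩ := Finset.mem_filter.1 hq
    have hq3 : sym (q - 1) ≠ sym p := by
      rw [hs]
      exact fun h => (hq2.resolve_left (by lia)) h.symm
    have hne : p ≠ q - 1 := fun h => hq3 (h ▸ rfl)
    -- The first change of symbol behind `p` is a kept position, because its predecessor still
    -- carries the symbol of `p`.
    have hex : ∃ x, p < x ∧ sym x ≠ sym p := ⟨q - 1, by lia, hq3⟩
    obtain ⟨hx1, hx2⟩ := Nat.find_spec hex
    have hx3 : Nat.find hex ≤ q - 1 := Nat.find_min' hex ⟨by lia, hq3⟩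
    have hx4 := fun y (hy : y < Nat.find hex) => Nat.find_min hex hy
    generalize Nat.find hex = x at *
    rw [Finset.mem_range] at hq1
    refine ⟨x, Finset.mem_filter.2 ⟨Finset.mem_range.2 (by lia), Or.inr ?_⟩, hx1, by lia, hx2⟩
    by_cases h : x - 1 = p
    · rwa [h]
    · have := hx4 (x - 1) (by lia)
      push Not at this
      rwa [this (by lia)]
  · refine Finset.card_le_card fun a ha => ?_
    obtain ⟨p, hp, rfl⟩ := Finset.mem_image.1 ha
    have hex : ∃ x, sym x = sym p := ⟨p, rfl⟩
    have hx1 := Nat.find_spec hex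
    have hx2 := Nat.find_min' hex rfl
    have hx3 := fun y (hy : y < Nat.find hex) => Nat.find_min hex hy
    generalize Nat.find hex = x at *
    rw [Finset.mem_range] at hp
    refine Finset.mem_image.2 ⟨x, Finset.mem_filter.2 ⟨Finset.mem_range.2 (by lia), ?_⟩, hx1⟩
    by_cases h0 : x = 0
    · exact Or.inl h0
    · exact Or.inr fun h => hx3 (x - 1) (by lia) (h.symm.trans hx1)
  · conv_lhs => rw [← Finset.card_range N]
    rw [← Finset.card_filter_add_card_filter_not (s := Finset.range N)
      (fun p => p = 0 ∨ sym p ≠ sym (p - 1))]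
    refine Nat.add_le_add_left ?_ _
    conv_rhs => rw [← Finset.card_range m]
    have key : ∀ p ∈ (Finset.range N).filter (fun p => ¬ (p = 0 ∨ sym p ≠ sym (p - 1))),
        p ∈ Finset.range N ∧ 0 < p ∧ b (p - 1) < b p := by
      intro p hp
      obtain ⟨hp1, hp2⟩ := Finset.mem_filter.1 hp
      push Not at hp2
      refine ⟨hp1, by lia, lt_of_le_of_ne (hb (Nat.sub_le _ _)) fun h => ?_⟩
      rw [Finset.mem_range] at hp1
      have := hB (p - 1) (Finset.mem_range.2 (by lia)) p (Finset.mem_range.2 hp1) hp2.2.symm h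
      lia
    have hlt : ∀ p ∈ (Finset.range N).filter (fun p => ¬ (p = 0 ∨ sym p ≠ sym (p - 1))),
        ∀ q ∈ (Finset.range N).filter (fun p => ¬ (p = 0 ∨ sym p ≠ sym (p - 1))),
        p < q → b p < b q := fun p _ q hq hpq =>
      (hb (show p ≤ q - 1 by lia)).trans_lt (key q hq).2.2
    refine Finset.card_le_card_of_injOn b
      (fun p hp => by simpa using hm p (key p hp).1) fun p hp q hq hpq => ?_
    rcases lt_trichotomy p q with h | h | h
    · exact absurd hpq (hlt p hp q hq h).ne
    · exact h
    · exact absurd hpq (hlt q hq p hp h).ne'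

/-! ### Nonemptiness and lower bound -/

theorem not_occurs_of_pairwise_le {S : List ℕ} (h : S.Pairwise (· ≤ ·)) :
    ¬ Occurs (alternating 7) S := by
  rintro ⟨τ, hτ, f, hf, rfl⟩
  have h7 : alternating 7 = [0, 1, 0, 1, 0, 1, 0] := by decide
  have h1 := h.sublist hτ
  rw [h7] at h1 hf
  simp only [List.map_cons, List.pairwise_cons, List.mem_cons] at h1
  have h2 : f 0 ≤ f 1 := h1.1 _ (Or.inl rfl)
  have h3 : f 1 ≤ f 0 := h1.2.1 _ (Or.inl rfl)
  exact absurd (hf (by simp) (by simp) (le_antisymm h2 h3)) (by norm_num)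

theorem mem_sparseLengths (n : ℕ) : n ∈ sparseLengths (alternating 7) n := by
  refine ⟨List.range n, not_occurs_of_pairwise_le (List.pairwise_lt_range.imp le_of_lt), ?_,
    fun i j hij hj h => ?_, List.length_range⟩
  · simp [alphabetSize, List.toFinset_range]
  · simp only [List.getElem_range] at h
    exact absurd h hij.ne

/-- The last symbol is repeated in singleton blocks. This gives nonemptiness and length at least
`m`, so the absolute value in the theorem only needs an upper bound. -/
theorem mem_blockedLengths {n m : ℕ} (hn : 1 ≤ n) (hm : 1 ≤ m) :
    n + (m - 1) ∈ blockedLengths (alternating 7) n m := by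
  refine ⟨List.range n ++ List.replicate (m - 1) (n - 1), not_occurs_of_pairwise_le ?_, ?_,
    ⟨List.range n :: List.replicate (m - 1) [n - 1], ?_, ?_, ?_⟩, by simp⟩
  · refine List.pairwise_append.2 ⟨List.pairwise_lt_range.imp le_of_lt,
      List.pairwise_replicate.2 (Or.inr le_rfl), fun a ha b hb => ?_⟩
    rw [List.mem_range] at ha
    rw [List.eq_of_mem_replicate hb]
    lia
  · have : (List.range n ++ List.replicate (m - 1) (n - 1)).toFinset = Finset.range n := by
      ext a
      simp only [List.mem_toFinset, List.mem_append, List.mem_range, List.mem_replicate,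
        Finset.mem_range]
      lia
    rw [alphabetSize, this, Finset.card_range]
  · simp
  · simp only [List.length_cons, List.length_replicate]
    lia
  · intro B hB
    rcases List.mem_cons.1 hB with rfl | hB
    · exact List.nodup_range
    · rw [List.eq_of_mem_replicate hB]
      exact List.nodup_singleton _

/-! ### Bounds for the extremal lengths -/

theorem exists_sparseLengths_bound : ∃ C : ℕ, ∀ n, 1 ≤ n →
    ∀ l ∈ sparseLengths (alternating 7) n, l ≤ C * (n * (invAck n * 2 ^ invAck n)) := by
  obtain ⟨C, hC⟩ := exists_sparse_bound
  refine ⟨C, fun n hn l hl => ?_⟩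
  obtain ⟨S, hS, rfl, hsp, rfl⟩ := hl
  rw [show alphabetSize (alternating 7) = 2 by decide] at hsp
  rw [alphabetSize_eq_numSym] at hn ⊢
  have := hC _ _ (hasOrder_of_not_occurs hS) (isSparse_of_sparse hsp) hn
  rwa [Finset.card_range] at this

theorem exists_blockedLengths_bound : ∃ C : ℕ, ∀ n m, 1 ≤ n → 1 ≤ m →
    ∀ l ∈ blockedLengths (alternating 7) n m,
      l ≤ m + C * (n * (invAck₂ n m * 2 ^ invAck₂ n m)) := by
  obtain ⟨C₁, hC₁⟩ := exists_sparse_bound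
  obtain ⟨C₂, hC₂⟩ := exists_blocked_bound
  refine ⟨C₁ + C₂, fun n m hn hm l hl => ?_⟩
  obtain ⟨S, hS, rfl, ⟨L, rfl, hLm, hL⟩, rfl⟩ := hl
  obtain ⟨b, hb, hB, hbL⟩ := exists_blocks L hL
  have hbm := fun p hp => (hbL p hp).trans_le hLm
  have hP := hasOrder_of_not_occurs hS
  rw [alphabetSize_eq_numSym] at hn ⊢
  set sym := fun p => L.flatten.getD p 0
  set N := L.flatten.length
  rw [add_mul]
  -- With more blocks than symbols, the at most `m` deleted positions provide the term `m` with
  -- coefficient exactly one.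
  rcases le_total m (numSym sym (Finset.range N)) with h | h
  · have := hC₂ sym b _ m hP hb hB hbm hm h
    rw [Finset.card_range] at this
    lia
  · obtain ⟨P, hPN, hPs, hPn, hcard⟩ := exists_sparse_subset hb hB hbm
    have h1 := hC₁ sym P (hP.mono hPN) hPs (hPn ▸ hn)
    rw [hPn] at h1
    have h2 := invAck_le_invAck₂ h
    have h3 := h1.trans (Nat.mul_le_mul_left C₁ (Nat.mul_le_mul_left _
      (Nat.mul_le_mul h2 (Nat.pow_le_pow_right (by lia) h2))))
    lia

end

end DavenportSchinzel

theorem mainTheorem2 :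
    (∃ C : ℝ, ∀ n : ℕ, 1 ≤ n →
      IsGreatest (DavenportSchinzel.sparseLengths (DavenportSchinzel.alternating 7) n)
        (DavenportSchinzel.dsSparse 5 n) ∧
      (DavenportSchinzel.dsSparse 5 n : ℝ) ≤
        C * ((n : ℝ) * (DavenportSchinzel.invAck n : ℝ) *
          (2 : ℝ) ^ DavenportSchinzel.invAck n)) ∧
    (∃ C : ℝ, ∀ n m : ℕ, 1 ≤ n → 1 ≤ m →
      IsGreatest (DavenportSchinzel.blockedLengths (DavenportSchinzel.alternating 7) n m)
        (DavenportSchinzel.dsBlocked 5 n m) ∧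
      |(DavenportSchinzel.dsBlocked 5 n m : ℝ) - (m : ℝ)| ≤
        C * ((n : ℝ) * (DavenportSchinzel.invAck₂ n m : ℝ) *
          (2 : ℝ) ^ DavenportSchinzel.invAck₂ n m)) := by
  constructor
  · obtain ⟨C, hC⟩ := DavenportSchinzel.exists_sparseLengths_bound
    refine ⟨C, fun n hn => ?_⟩
    have hmem : DavenportSchinzel.dsSparse 5 n ∈
        DavenportSchinzel.sparseLengths (DavenportSchinzel.alternating 7) n :=
      Nat.sSup_mem ⟨n, DavenportSchinzel.mem_sparseLengths n⟩ ⟨_, fun l hl => hC n hn l hl⟩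
    refine ⟨⟨hmem, fun l hl => le_csSup ⟨_, fun l hl => hC n hn l hl⟩ hl⟩, ?_⟩
    rw [mul_assoc]
    exact_mod_cast hC n hn _ hmem
  · obtain ⟨C, hC⟩ := DavenportSchinzel.exists_blockedLengths_bound
    refine ⟨C, fun n m hn hm => ?_⟩
    have hle := DavenportSchinzel.mem_blockedLengths hn hm
    have hbdd : BddAbove (DavenportSchinzel.blockedLengths (DavenportSchinzel.alternating 7) n m) :=
      ⟨_, fun l hl => hC n m hn hm l hl⟩
    have hmem : DavenportSchinzel.dsBlocked 5 n m ∈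
        DavenportSchinzel.blockedLengths (DavenportSchinzel.alternating 7) n m :=
      Nat.sSup_mem ⟨_, hle⟩ hbdd
    refine ⟨⟨hmem, fun l hl => le_csSup hbdd hl⟩, ?_⟩
    have h1 : n + (m - 1) ≤ DavenportSchinzel.dsBlocked 5 n m := le_csSup hbdd hle
    have h2 : (m : ℝ) ≤ DavenportSchinzel.dsBlocked 5 n m := by
      exact_mod_cast (show m ≤ n + (m - 1) by lia).trans h1
    rw [abs_of_nonneg (sub_nonneg.2 h2), sub_le_iff_le_add', mul_assoc]
    exact_mod_cast hC n m hn hm _ hmem
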